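/- Let $k$ be a field. By a hereditary abelian category we mean a $k$-linear abelian category $\mathcal H$ with $\operatorname{Ext}^2_{\mathcal H}(-,-)=0$ all of whose spaces $\operatorname{Hom}_{\mathcal H}(X,Y)$ and $\operatorname{Ext}^n_{\mathcal H}(X,Y)$ are finite-dimensional over $k$. An object $T$ of the bounded derived category $\mathcal D^b(\mathcal H)$ is a \emph{silting complex} over $\mathcal H$ if $\operatorname{Hom}(T,T[n])=0$ for all $n>0$ and the smallest thick subcategory containing $T$ is $\mathcal D^b(\mathcal H)$. It is \emph{$2$-term} if moreover $\operatorname{Hom}(T,M[i])=0$ for all $M\in\mathcal H$ and all integers $i\neq 0,1$, and \emph{basic} if it is a finite direct sum of pairwise non-isomorphic indecomposable objects. Let $\mathcal E$ be the class of $k$-algebras isomorphic to $\operatorname{End}_{\mathcal D^b(\mathcal H)}(T)$ for some basic silting complex $T$ over some hereditary abelian category $\mathcal H$; such an algebra is \emph{quasi-silted} if $\mathcal H$ and $T$ can be chosen with $T$ basic and $2$-term silting. For $D\in\mathcal D^b(\mathcal H)$ put \[ D^{\perp_{\mathbb Z}}=\{M\in\mathcal H \mid \operatorname{Hom}_{\mathcal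 D^b(\mathcal H)}(D,M[i])=0 \text{ for all } i\in\mathbb Z\}. \] \textbf{Theorem.} Let $A$ be a $k$-algebra and $e\in A$ an idempotent. \begin{enumerate} \item[(a)] If $A\in\mathcal E$, then $A/AeA\in\mathcal E$. \item[(b)] If $A$ is quasi-silted, then $A/AeA$ is quasi-silted. \item[(c)] More precisely, let $\mathcal H$ be a hereditary abelian category, $T$ a silting complex over $\mathcal H$, and $A\cong\operatorname{End}_{\mathcal D^b(\mathcal H)}(T)$. Then $e$ is the idempotent of a direct summand $D$ of $T$ (that is, the endomorphism of $T$ corresponding to $e$ factors as $T\xrightarrow{r}D\xrightarrow{i}T$ with $r\circ i=\mathrm{id}_D$), the full subcategory $D^{\perp_{\mathbb Z}}$ of $\mathcal H$ contains $0$ and is closed under kernels, cokernels and finite direct sums, it is a hereditary abelian category in the above sense, and there is a silting complex $T'$ over $D^{\perp_{\mathbb Z}}$ with $A/AeA\cong\operatorname{End}_{\mathcal D^b(D^{\perp_{\mathbb Z}})}(T')$ as $k$-algebras, such that $T'$ is basic if $T$ is basic and $T'$ is $2$-term if $T$ is $2$-term. \end{enumerate} -/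

import Mathlib

open CategoryTheory CategoryTheory.Limits CategoryTheory.Abelian

universe v u

/- Derived categories are taken in their standard (localization) model. -/
attribute [local instance] HasDerivedCategory.standard

namespace SiltingQuotient

section Triangulated

variable {C : Type u} [Category.{v} C] [HasZeroObject C] [HasShift C ℤ] [Preadditive C]
  [∀ n : ℤ, (shiftFunctor C n).Additive] [Pretriangulated C]

/-- `T` is presilting: `Hom(T, T[n]) = 0` for all `n > 0`. -/
def IsPresilting (T : C) : Prop :=
  ∀ n : ℤ, 0 < n → ∀ f : T ⟶ T⟦n⟧, f = 0

/-- `T` is silting: it is presilting and the smallest thick subcategory containing `T`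
is the whole category. -/
def IsSilting (T : C) : Prop :=
  IsPresilting T ∧ (ObjectProperty.singleton T).triangEnvelope = ⊤

/-- `T` is basic: it is a finite direct sum of pairwise non-isomorphic indecomposable objects. -/
def IsBasic (T : C) : Prop :=
  ∃ (n : ℕ) (X : Fin n → C), (∀ i, Indecomposable (X i)) ∧
    (∀ i j, i ≠ j → IsEmpty (X i ≅ X j)) ∧ Nonempty (T ≅ ⨁ X)

end Triangulated

section Hereditary

/-- The `k`-linear abelian category `H` is hereditary, Hom-finite and Ext-finite. -/
structure IsFiniteHereditary (k : Type*) [Field k]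
    (H : Type u) [Category.{v} H] [Abelian H] [Linear k H] : Prop where
  hom_finite : ∀ X Y : H, Module.Finite k (X ⟶ Y)
  ext_finite : letI := HasExt.standard H
    ∀ (X Y : H) (n : ℕ), Module.Finite k (Ext.{max u v} X Y n)
  ext_two : letI := HasExt.standard H
    ∀ X Y : H, Subsingleton (Ext.{max u v} X Y 2)

variable {H : Type u} [Category.{v} H] [Abelian H]

/-- `T` is two-term: `Hom(T, M[i]) = 0` for all `M` in `H` and all `i ≠ 0, 1`. -/
def IsTwoTerm (T : DerivedCategory.Bounded H) : Prop :=
  ∀ (M : H) (i : ℤ), i ≠ 0 → i ≠ 1 →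
    ∀ f : T.obj ⟶ ((DerivedCategory.singleFunctor H 0).obj M)⟦i⟧, f = 0

/-- The full subcategory of those `M` in `H` with `Hom(D, M[i]) = 0` for all integers `i`. -/
def perpZ (D : DerivedCategory.Bounded H) : ObjectProperty H :=
  fun M => ∀ (i : ℤ) (f : D.obj ⟶ ((DerivedCategory.singleFunctor H 0).obj M)⟦i⟧), f = 0

end Hereditary

/-- The `k`-algebra `A` is isomorphic to the endomorphism algebra of a basic silting complex
over some hereditary abelian category. -/
def IsSiltingEndAlgebra (k : Type*) [Field k] (A : Type*) [Ring A] [Algebra k A] : Prop :=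
  ∃ (H : Type u) (_ : Category.{v} H) (_ : Abelian H) (_ : Linear k H)
    (T : DerivedCategory.Bounded H),
    IsFiniteHereditary k H ∧ IsSilting T ∧ IsBasic T ∧ Nonempty (A ≃ₐ[k] End T)

/-- The `k`-algebra `A` is quasi-silted: it is isomorphic to the endomorphism algebra of a basic
two-term silting complex over some hereditary abelian category. -/
def IsQuasiSilted (k : Type*) [Field k] (A : Type*) [Ring A] [Algebra k A] : Prop :=
  ∃ (H : Type u) (_ : Category.{v} H) (_ : Abelian H) (_ : Linear k H)
    (T : DerivedCategory.Bounded H),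
    IsFiniteHereditary k H ∧ IsSilting T ∧ IsTwoTerm T ∧ IsBasic T ∧ Nonempty (A ≃ₐ[k] End T)

/-- The quotient algebra `A / AeA`. -/
abbrev IdemQuotient {A : Type*} [Ring A] (e : A) : Type _ :=
  (TwoSidedIdeal.span {e}).ringCon.Quotient

end SiltingQuotient

/-!
Write `C = D^b(H)` and let `D` be a direct summand of the silting complex `T`. Since `Ext² = 0`,
every object of `C` is the direct sum of its shifted cohomology objects, and as `D` is presilting,
killing the maps from the shifts `D[s]` one degree at a time, beginning with the lowest, terminates
in a left approximation `T ⟶ T'` by an object `T'` receiving no maps from any `D[s]`. Maps from `T`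
to `T'` lift along it, and the maps `T ⟶ T` that it annihilates are the ones which factor through
sums of copies of `D`. Hence `T'` is silting in the perpendicular subcategory of `D`, with
endomorphism algebra `A / AeA`.

That subcategory is `D^b(W)` with `W = perpZ D`: as `Ext² = 0`, `W` is closed under kernels,
cokernels and extensions, so the inclusion `W ⟶ H` is exact and bijective on `Ext⁰` and `Ext¹`, and
injective on `Ext²`. Then `Ext²` vanishes on `W` too, and dévissage shows that
`D^b(W) ⟶ D^b(H)` is fully faithful with image the perpendicular subcategory.
-/

namespace SiltingQuotient

open Pretriangulated Triangulated

section Vanishing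

lemma forall_hom_eq_zero_congr {C D : Type*} [Category* C] [Category* D] [HasZeroMorphisms C]
    [HasZeroMorphisms D] {X Y : C} {X' Y' : D} (e : (X ⟶ Y) ≃ (X' ⟶ Y')) :
    (∀ f : X ⟶ Y, f = 0) ↔ ∀ f : X' ⟶ Y', f = 0 := by
  simpa only [subsingleton_iff_forall_eq (0 : _ ⟶ _)] using e.subsingleton_congr

lemma hom_map_biproduct_eq_zero {C D : Type*} [Category* C] [Category* D] [Preadditive C]
    [Preadditive D] [HasFiniteBiproducts C] (G : C ⥤ D) [G.Additive] {A : D} {n : ℕ}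
    {Z : Fin n → C} (h : ∀ i, ∀ f : A ⟶ G.obj (Z i), f = 0) (f : A ⟶ G.obj (⨁ Z)) : f = 0 := by
  rw [← cancel_mono (G.mapBiproduct Z).hom, zero_comp]
  exact biproduct.hom_ext _ _ fun i => (h i _).trans zero_comp.symm

variable {C : Type u} [Category.{v} C] [Preadditive C] [HasShift C ℤ] {X Y : C}

lemma hom_shift_shift_eq_zero_iff {a b c : ℤ} (h : a + b = c) :
    (∀ f : X ⟶ Y⟦a⟧⟦b⟧, f = 0) ↔ ∀ f : X ⟶ Y⟦c⟧, f = 0 :=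
  forall_hom_eq_zero_congr ((Iso.refl X).homCongr ((shiftFunctorAdd' C a b c h).symm.app Y))

lemma shift_hom_eq_zero_iff (a : ℤ) :
    (∀ f : X⟦a⟧ ⟶ Y, f = 0) ↔ ∀ f : X ⟶ Y⟦-a⟧, f = 0 :=
  forall_hom_eq_zero_congr ((shiftEquiv C a).toAdjunction.homEquiv X Y)

lemma shift_hom_shift_eq_zero_iff {a b c : ℤ} (h : a + c = b) :
    (∀ f : X⟦a⟧ ⟶ Y⟦b⟧, f = 0) ↔ ∀ f : X ⟶ Y⟦c⟧, f = 0 :=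
  (shift_hom_eq_zero_iff a).trans (hom_shift_shift_eq_zero_iff (by lia))

end Vanishing

section ShiftPerp

variable {C : Type u} [Category.{v} C] [Preadditive C] [HasShift C ℤ]

/-- The right orthogonal of all shifts of `D`: the objects `Y` such that `Hom(D, Y⟦i⟧) = 0` for
all integers `i`. -/
def shiftPerp (D : C) : ObjectProperty C :=
  fun Y => ∀ (i : ℤ) (f : D ⟶ Y⟦i⟧), f = 0

lemma shiftPerp_iff {D Y : C} : shiftPerp D Y ↔ ∀ (s : ℤ) (f : D⟦s⟧ ⟶ Y), f = 0 := by
  simp_rw [shift_hom_eq_zero_iff]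
  exact (Equiv.neg ℤ).forall_congr_right.symm

lemma shiftPerp_eq_rightOrthogonal (D : C) :
    shiftPerp D = ((ObjectProperty.singleton D).shiftClosure ℤ).rightOrthogonal := by
  ext Y
  rw [shiftPerp_iff]
  refine ⟨?_, fun h s f => h f ⟨D, s, Iso.refl _, by simp⟩⟩
  rintro h X f ⟨_, s, e, ⟨_⟩⟩
  rw [← cancel_epi e.inv, comp_zero]
  exact h s _

instance (D : C) : (shiftPerp D).IsStableUnderRetracts where
  of_retract {X Y} r h i f := by
    rw [← Category.comp_id f, ← (r.map (shiftFunctor C i)).retract, reassoc_of% (h i (f ≫ _)),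
      zero_comp]

variable [HasZeroObject C] [∀ n : ℤ, (shiftFunctor C n).Additive] [Pretriangulated C]

instance (D : C) : (shiftPerp D).IsTriangulated := by
  rw [shiftPerp_eq_rightOrthogonal]
  infer_instance

end ShiftPerp

section HomsThrough

variable {C : Type u} [Category.{v} C] [Preadditive C]

/-- The morphisms `X ⟶ Y` in the ideal generated by `Z`: the finite sums of morphisms which factor
through `Z`. -/
def homsThrough (Z X Y : C) : AddSubgroup (X ⟶ Y) :=
  AddSubgroup.closure {f | ∃ (a : X ⟶ Z) (b : Z ⟶ Y), a ≫ b = f}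

lemma comp_mem_homsThrough {X Y Z : C} (a : X ⟶ Z) (b : Z ⟶ Y) : a ≫ b ∈ homsThrough Z X Y :=
  AddSubgroup.subset_closure ⟨a, b, rfl⟩

lemma homsThrough_le {X Y Z : C} {S : AddSubgroup (X ⟶ Y)} :
    homsThrough Z X Y ≤ S ↔ ∀ (a : X ⟶ Z) (b : Z ⟶ Y), a ≫ b ∈ S := by
  rw [homsThrough, AddSubgroup.closure_le]
  exact ⟨fun h a b => h ⟨a, b, rfl⟩, by rintro h _ ⟨a, b, rfl⟩; exact h a b⟩

lemma homsThrough_eq_bot {X Z : C} (h : ∀ f : X ⟶ Z, f = 0) (Y : C) : homsThrough Z X Y = ⊥ :=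
  le_bot_iff.1 (homsThrough_le.2 fun a b => by simp [h a])

lemma homsThrough_le_of_iso {Z Z' : C} (α : Z ≅ Z') (X Y : C) :
    homsThrough Z X Y ≤ homsThrough Z' X Y :=
  homsThrough_le.2 fun a b => by simpa using comp_mem_homsThrough (a ≫ α.hom) (α.inv ≫ b)

lemma comp_biproduct_mem_homsThrough [HasFiniteBiproducts C] {X Y Z : C} {n : ℕ}
    (a : X ⟶ ⨁ fun _ : Fin n => Z) (b : (⨁ fun _ : Fin n => Z) ⟶ Y) :
    a ≫ b ∈ homsThrough Z X Y := by
  have h : a ≫ b = ∑ i, (a ≫ biproduct.π (fun _ : Fin n => Z) i) ≫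
      biproduct.ι (fun _ : Fin n => Z) i ≫ b := by
    simp_rw [Category.assoc, ← Preadditive.comp_sum, ← Category.assoc (biproduct.π _ _),
      ← Preadditive.sum_comp, biproduct.total, Category.id_comp]
  exact h ▸ sum_mem fun i _ => comp_mem_homsThrough _ _

end HomsThrough

section Approximation

variable {C : Type u} [Category.{v} C] [Preadditive C]

lemma exists_right_approximation [HasFiniteBiproducts C] (k : Type*) [Semiring k] [Linear k C]
    (Z X : C) [Module.Finite k (Z ⟶ X)] :
    ∃ (n : ℕ) (g : (⨁ fun _ : Fin n => Z) ⟶ X), ∀ f : Z ⟶ X, ∃ f', f' ≫ g = f := by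
  obtain ⟨n, g, hg⟩ := Module.Finite.exists_fin (R := k) (M := (Z ⟶ X))
  refine ⟨n, biproduct.desc g, fun f => ?_⟩
  obtain ⟨c, rfl⟩ := (Submodule.mem_span_range_iff_exists_fun k).1 (hg ▸ Submodule.mem_top (x := f))
  exact ⟨biproduct.lift fun i => c i • 𝟙 Z, by simp [biproduct.lift_desc]⟩

variable [HasShift C ℤ]

/-- `p : X ⟶ X'` is a left `shiftPerp D`-approximation obtained by killing the maps from
`D⟦s₀⟧, D⟦s₀ + 1⟧, …`. The last two fields record what remains of this construction for maps out of
objects `A` that have no maps to `D⟦s₀ + 1⟧, D⟦s₀ + 2⟧, …`. -/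
structure IsApproximation (D : C) (s₀ : ℤ) {X X' : C} (p : X ⟶ X') : Prop where
  isLocal : (shiftPerp D).isLocal p
  exists_lift {A : C} (hA : ∀ s > s₀, ∀ f : A ⟶ D⟦s⟧, f = 0) (g : A ⟶ X') : ∃ g', g' ≫ p = g
  mem_homsThrough {A : C} (hA : ∀ s > s₀, ∀ f : A ⟶ D⟦s⟧, f = 0) (f : A ⟶ X) (hf : f ≫ p = 0) :
    f ∈ homsThrough (D⟦s₀⟧) A X

namespace IsApproximation

variable {D X X' : C} {s₀ : ℤ} {p : X ⟶ X'}

lemma of_isIso (D : C) (s₀ : ℤ) (p : X ⟶ X') [IsIso p] : IsApproximation D s₀ p where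
  isLocal := ObjectProperty.isLocal_of_isIso _ p
  exists_lift _ g := ⟨g ≫ inv p, by simp⟩
  mem_homsThrough _ f hf := by
    rw [(Preadditive.IsIso.comp_right_eq_zero f p).1 hf]
    exact zero_mem _

lemma comp {X'' : C} {q : X' ⟶ X''} (hp : IsApproximation D s₀ p)
    (hq : IsApproximation D (s₀ + 1) q) : IsApproximation D s₀ (p ≫ q) where
  isLocal := MorphismProperty.comp_mem _ _ _ hp.isLocal hq.isLocal
  exists_lift hA g := by
    obtain ⟨g₁, rfl⟩ := hq.exists_lift (fun s hs => hA s (by lia)) g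
    obtain ⟨g₂, rfl⟩ := hp.exists_lift hA g₁
    exact ⟨g₂, by simp⟩
  mem_homsThrough {A} hA f hf := by
    have hfp := hq.mem_homsThrough (fun s hs => hA s (by lia)) (f ≫ p) (by simpa using hf)
    rw [homsThrough_eq_bot (hA _ (lt_add_one s₀)), AddSubgroup.mem_bot] at hfp
    exact hp.mem_homsThrough hA f hfp

lemma comp_of_section (hp : IsApproximation D s₀ p) {R : C} {π : X' ⟶ R} {σ : R ⟶ X'}
    (hσ : σ ≫ π = 𝟙 R) (h : p ≫ π ≫ σ = p) : IsApproximation D s₀ (p ≫ π) where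
  isLocal Y hY := by
    refine ⟨fun g₁ g₂ hg => ?_, fun g => ?_⟩
    · have : π ≫ g₁ = π ≫ g₂ := (hp.isLocal Y hY).1 (by simpa using hg)
      rw [← Category.id_comp g₁, ← Category.id_comp g₂, ← hσ, Category.assoc, this, Category.assoc]
    · obtain ⟨g', rfl⟩ := (hp.isLocal Y hY).2 g
      exact ⟨σ ≫ g', by simp [reassoc_of% h]⟩
  exists_lift hA g := by
    obtain ⟨g', hg'⟩ := hp.exists_lift hA (g ≫ σ)
    exact ⟨g', by rw [reassoc_of% hg', hσ, Category.comp_id]⟩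
  mem_homsThrough hA f hf := hp.mem_homsThrough hA f (by rw [← h, reassoc_of% hf, zero_comp])

lemma of_isLocal (hp : IsApproximation D s₀ p) (hX' : shiftPerp D X') {X'' : C} {q : X ⟶ X''}
    (hq : (shiftPerp D).isLocal q) (hX'' : shiftPerp D X'') : IsApproximation D s₀ q := by
  obtain ⟨c, rfl⟩ := (hp.isLocal X'' hX'').2 q
  have hc : IsIso c := ((shiftPerp D).isLocal_iff_isIso c hX' hX'').1
    (MorphismProperty.of_precomp _ _ _ hp.isLocal hq)
  exact hp.comp_of_section (IsIso.inv_hom_id c) (by simp)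

end IsApproximation

variable [HasZeroObject C] [∀ n : ℤ, (shiftFunctor C n).Additive] [Pretriangulated C]

lemma isLocal_of_distTriang {P : ObjectProperty C} [P.IsStableUnderShift ℤ] {T : Triangle C}
    (hT : T ∈ distTriang C) (h₁ : P.leftOrthogonal T.obj₁) : P.isLocal T.mor₂ := by
  intro Y hY
  have hY' : P.leftOrthogonal.trW.isLocal Y := by
    rw [ObjectProperty.isLocal_trW]
    exact fun X f hX => hX f hY
  exact hY' _ ((P.leftOrthogonal.trW_iff' _).2 ⟨_, _, _, hT, h₁⟩)

lemma IsApproximation.of_distTriang {D X X' : C} {s₀ : ℤ} {p : X ⟶ X'}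
    {n : ℕ} {f : (⨁ fun _ : Fin n => D⟦s₀⟧) ⟶ X}
    {δ : X' ⟶ (⨁ fun _ : Fin n => D⟦s₀⟧)⟦(1 : ℤ)⟧} (hT : Triangle.mk f p δ ∈ distTriang C) :
    IsApproximation D s₀ p where
  isLocal := isLocal_of_distTriang hT fun Y f hY =>
    biproduct.hom_ext' _ _ fun _ => (shiftPerp_iff.1 hY s₀ _).trans comp_zero.symm
  exists_lift hA g := by
    obtain ⟨g', hg'⟩ := Triangle.coyoneda_exact₃ _ hT g (hom_map_biproduct_eq_zero _
      (fun _ => (hom_shift_shift_eq_zero_iff rfl).2 (hA _ (lt_add_one s₀))) _)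
    exact ⟨g', hg'.symm⟩
  mem_homsThrough _ g hg := by
    obtain ⟨g', rfl⟩ := Triangle.coyoneda_exact₂ _ hT g hg
    exact comp_biproduct_mem_homsThrough _ _

/-- The maps from `D⟦s₀⟧, …, D⟦s₀ + n - 1⟧` are killed one degree at a time: since `D` is
presilting, no new maps from the earlier shifts are created. -/
lemma exists_isApproximation (k : Type*) [Semiring k] [Linear k C]
    [∀ X Y : C, Module.Finite k (X ⟶ Y)] {D : C} (hD : IsPresilting D) (n : ℕ) {X : C} {s₀ : ℤ}
    (hX : ∀ s < s₀, ∀ f : D⟦s⟧ ⟶ X, f = 0) :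
    ∃ (X' : C) (p : X ⟶ X'), IsApproximation D s₀ p ∧ ∀ s < s₀ + n, ∀ f : D⟦s⟧ ⟶ X', f = 0 := by
  induction n generalizing X s₀ with
  | zero => exact ⟨X, 𝟙 X, .of_isIso D s₀ _, by simpa using hX⟩
  | succ n ih =>
    obtain ⟨m, g, hg⟩ := exists_right_approximation k (D⟦s₀⟧) X
    obtain ⟨X₁, q, δ, hT⟩ := distinguished_cocone_triangle g
    have hq := IsApproximation.of_distTriang hT
    have hX₁ : ∀ s < s₀ + 1, ∀ f : D⟦s⟧ ⟶ X₁, f = 0 := by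
      intro s hs f
      obtain ⟨f', rfl⟩ := hq.exists_lift (fun s' hs' =>
        (shift_hom_shift_eq_zero_iff (add_sub_cancel s s')).2 (hD _ (by lia))) f
      obtain hs | rfl := (Int.lt_add_one_iff.1 hs).lt_or_eq
      · rw [hX s hs f', zero_comp]
      · obtain ⟨f'', rfl⟩ := hg f'
        rw [Category.assoc, show g ≫ q = 0 from comp_distTriang_mor_zero₁₂ _ hT, comp_zero]
    obtain ⟨X', p, hp, hX'⟩ := ih hX₁
    exact ⟨X', q ≫ p, hq.comp hp, fun s hs => hX' s (by push_cast at hs; lia)⟩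

end Approximation

section TStructure

variable {C : Type u} [Category.{v} C] [HasZeroObject C] [HasShift C ℤ] [Preadditive C]
  [∀ n : ℤ, (shiftFunctor C n).Additive] [Pretriangulated C] {t : TStructure C}

lemma prop_of_isGE_of_isLE_of_distTriang [IsTriangulated C] {P : ObjectProperty C} {a b : ℤ}
    (hab : a ≤ b) (h₀ : ∀ n, a ≤ n → n ≤ b → ∀ X, t.IsGE X n → t.IsLE X n → P X)
    (h₁ : ∀ n, ∀ T ∈ distTriang C, t.IsLE T.obj₁ n → t.IsGE T.obj₃ (n + 1) →
      P T.obj₁ → P T.obj₃ → P T.obj₂)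
    {X : C} (ha : t.IsGE X a) (hb : t.IsLE X b) : P X := by
  induction b, hab using Int.leInduction generalizing X with
  | base => exact h₀ a le_rfl le_rfl X ha hb
  | succ n han ih =>
    refine h₁ n _ (t.triangleLEGE_distinguished n (n + 1) rfl X)
      (inferInstanceAs (t.IsLE ((t.truncLE n).obj X) n))
      (inferInstanceAs (t.IsGE ((t.truncGE (n + 1)).obj X) (n + 1))) ?_ ?_
    · exact ih (fun m ham hmn => h₀ m ham (by lia))
        (inferInstanceAs (t.IsGE ((t.truncLE n).obj X) a))
        (inferInstanceAs (t.IsLE ((t.truncLE n).obj X) n))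
    · exact h₀ (n + 1) (by lia) le_rfl _
        (inferInstanceAs (t.IsGE ((t.truncGE (n + 1)).obj X) (n + 1)))
        (inferInstanceAs (t.IsLE ((t.truncGE (n + 1)).obj X) (n + 1)))

lemma prop_of_isGE_of_isLE [IsTriangulated C] {P : ObjectProperty C} [P.IsTriangulatedClosed₂]
    [P.IsClosedUnderIsomorphisms] {a b : ℤ} (hab : a ≤ b)
    (h : ∀ n, a ≤ n → n ≤ b → ∀ X, t.IsGE X n → t.IsLE X n → P X)
    {X : C} (ha : t.IsGE X a) (hb : t.IsLE X b) : P X :=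
  prop_of_isGE_of_isLE_of_distTriang hab h
    (fun _ T hT _ _ => P.ext_of_isTriangulatedClosed₂ T hT) ha hb

variable (t) in
/-- A bounded t-structure is hereditary if there are no nonzero morphisms from objects that are
`≥ a` to objects that are `≤ a - 2`. -/
structure IsBoundedHereditary : Prop where
  bounded (X : C) : t.bounded X
  hom_eq_zero {X Y : C} {a b : ℤ} (h : b + 2 ≤ a) (hX : t.IsGE X a) (hY : t.IsLE Y b)
    (f : X ⟶ Y) : f = 0

namespace IsBoundedHereditary

lemma mor₃_eq_zero (ht : IsBoundedHereditary t) {T : Triangle C} {n : ℤ}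
    (h₁ : t.IsLE T.obj₁ n) (h₃ : t.IsGE T.obj₃ (n + 1)) : T.mor₃ = 0 :=
  ht.hom_eq_zero (a := n + 1) (b := n - 1) (by lia) h₃ (t.isLE_shift T.obj₁ n 1 (n - 1)) _

lemma prop_of_biprod [IsTriangulated C] (ht : IsBoundedHereditary t) {P : ObjectProperty C}
    [P.IsClosedUnderIsomorphisms] (h₀ : ∀ n X, t.IsGE X n → t.IsLE X n → P X)
    (h₁ : ∀ n X Y, t.IsLE X n → t.IsGE Y (n + 1) → P X → P Y → P (X ⊞ Y)) (X : C) : P X := by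
  obtain ⟨⟨a, ha⟩, ⟨b, hb⟩⟩ := ht.bounded X
  have := t.isGE_of_ge X (min a b) a
  refine prop_of_isGE_of_isLE_of_distTriang (min_le_right a b) (fun n _ _ => h₀ n)
    (fun n T hT hL hR h h' => ?_) this hb
  obtain ⟨e, -⟩ := exists_iso_binaryBiproduct_of_distTriang T hT (ht.mor₃_eq_zero hL hR)
  exact P.prop_of_iso e.symm (h₁ n _ _ hL hR h h')

lemma exists_forall_lt_hom_eq_zero (ht : IsBoundedHereditary t) (D X : C) :
    ∃ s₀ : ℤ, ∀ s < s₀, ∀ f : D⟦s⟧ ⟶ X, f = 0 := by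
  obtain ⟨a, ha⟩ := (ht.bounded D).1
  obtain ⟨b, hb⟩ := (ht.bounded X).2
  exact ⟨a - b - 1, fun s hs =>
    ht.hom_eq_zero (a := a - s) (by lia) (t.isGE_shift D a s (a - s)) hb⟩

/-- Once the maps from `D⟦s₀⟧, …, D⟦s₀ + n - 1⟧` are killed for a sufficiently large `n`, the
truncation splits off the part which still receives maps from shifts of `D`. -/
lemma exists_isApproximation (ht : IsBoundedHereditary t) (k : Type*) [Semiring k] [Linear k C]
    [∀ X Y : C, Module.Finite k (X ⟶ Y)] {D : C} (hD : IsPresilting D) {X : C} {s₀ : ℤ}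
    (hX : ∀ s < s₀, ∀ f : D⟦s⟧ ⟶ X, f = 0) :
    ∃ (X' : C) (p : X ⟶ X'), shiftPerp D X' ∧ IsApproximation D s₀ p := by
  obtain ⟨a, ha⟩ := (ht.bounded X).1
  obtain ⟨d, hd⟩ := (ht.bounded D).2
  obtain ⟨n, hn⟩ : ∃ n : ℕ, d + 2 - a ≤ s₀ + n := ⟨(d + 2 - a - s₀).toNat, by lia⟩
  obtain ⟨X₁, p, hp, hX₁⟩ := SiltingQuotient.exists_isApproximation k hD n hX
  let N := d - (s₀ + n)
  obtain ⟨L, R, hL, hR, u, v, w, hT⟩ := t.exists_triangle X₁ N (N + 1) rfl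
  replace hL : t.IsLE L N := ⟨hL⟩
  replace hR : t.IsGE R (N + 1) := ⟨hR⟩
  have hw : w = 0 := ht.mor₃_eq_zero (T := .mk u v w) hL hR
  obtain ⟨σ, hσ⟩ : ∃ σ : R ⟶ X₁, 𝟙 R = σ ≫ v :=
    Triangle.coyoneda_exact₃ _ hT (𝟙 R) ((Category.id_comp w).trans hw)
  have hpvσ : p ≫ v ≫ σ = p := by
    obtain ⟨x, hx⟩ : ∃ x : X ⟶ L, p - p ≫ v ≫ σ = x ≫ u := by
      refine Triangle.coyoneda_exact₂ _ hT _ (?_ : (p - p ≫ v ≫ σ) ≫ v = 0)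
      simp [← hσ]
    rw [ht.hom_eq_zero (by lia) ha hL x, zero_comp, sub_eq_zero] at hx
    exact hx.symm
  refine ⟨R, p ≫ v, shiftPerp_iff.2 fun s f => ?_, hp.comp_of_section hσ.symm hpvσ⟩
  by_cases hs : s < s₀ + n
  · rw [← Category.comp_id f, hσ, reassoc_of% hX₁ s hs (f ≫ σ), zero_comp]
  · have := t.isLE_shift D d s (d - s)
    exact t.zero f (d - s) (N + 1)

end IsBoundedHereditary

end TStructure

section Idempotents

variable {C : Type u} [Category.{v} C]

/-- The objects all of whose idempotent endomorphisms split. -/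
def idempotentsSplit : ObjectProperty C := fun X =>
  ∀ p : X ⟶ X, p ≫ p = p → ∃ (Y : C) (i : Y ⟶ X) (e : X ⟶ Y), i ≫ e = 𝟙 Y ∧ e ≫ i = p

instance : (idempotentsSplit (C := C)).IsClosedUnderIsomorphisms where
  of_iso e hX p hp := (Idempotents.split_iff_of_iso e (e.hom ≫ p ≫ e.inv) p (by simp)).1
    (hX _ (by simp [reassoc_of% hp]))

lemma idempotentsSplit_obj {D : Type*} [Category* D] (F : C ⥤ D) [F.Full]
    [F.Faithful] {X : C} (hX : idempotentsSplit X) : idempotentsSplit (F.obj X) := by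
  intro p hp
  obtain ⟨q, rfl⟩ := F.map_surjective p
  obtain ⟨Y, i, e, hie, hei⟩ := hX q (F.map_injective (by simpa using hp))
  exact ⟨F.obj Y, F.map i, F.map e, by simp [← Functor.map_comp, hie],
    by simp [← Functor.map_comp, hei]⟩

variable [Preadditive C]

lemma split_of_sub_comp_sub_eq_zero {X Y : C} {p q : X ⟶ X} (hp : p ≫ p = p) {i : Y ⟶ X}
    {e : X ⟶ Y} (hie : i ≫ e = 𝟙 Y) (hei : e ≫ i = q) (h : (p - q) ≫ (p - q) = 0) :
    ∃ (Y : C) (i : Y ⟶ X) (e : X ⟶ Y), i ≫ e = 𝟙 Y ∧ e ≫ i = p := by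
  have hq : q ≫ q = q := by rw [← hei, Category.assoc, reassoc_of% hie]
  have hpq : p ≫ q + q ≫ p = p + q := by
    simp only [Preadditive.sub_comp, Preadditive.comp_sub, hp, hq] at h
    rw [← sub_eq_zero, ← neg_eq_zero, ← h]
    abel
  have hqpq : q ≫ p ≫ q = q := by simpa [hq, reassoc_of% hq] using q ≫= hpq =≫ q
  have hpqp : p ≫ q ≫ p = p := by simpa [hp, reassoc_of% hp] using p ≫= hpq =≫ p
  refine ⟨Y, i ≫ p, p ≫ e, ?_, by simpa [reassoc_of% hei] using hpqp⟩
  subst hei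
  simpa [hie, reassoc_of% hie, reassoc_of% hp] using i ≫= hqpq =≫ e

/-- An idempotent of `X ⊞ Y` is triangular, and it splits because its diagonal part does. -/
lemma idempotentsSplit_biprod [HasBinaryBiproducts C] {X Y : C} (h : ∀ f : X ⟶ Y, f = 0)
    (hX : idempotentsSplit X) (hY : idempotentsSplit Y) : idempotentsSplit (X ⊞ Y) := by
  intro p hp
  have hXY := h (biprod.inl ≫ p ≫ biprod.snd)
  have hinl : biprod.inl ≫ p = biprod.inl ≫ p ≫ biprod.fst ≫ biprod.inl := by
    ext <;> simp [hXY]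
  have hsnd : p ≫ biprod.snd = biprod.snd ≫ biprod.inr ≫ p ≫ biprod.snd := by
    ext <;> simp [hXY]
  obtain ⟨X', i, e, hie, hei⟩ := hX (biprod.inl ≫ p ≫ biprod.fst) (by
    simp only [Category.assoc]
    rw [← reassoc_of% hinl, reassoc_of% hp])
  obtain ⟨Y', i', e', hie', hei'⟩ := hY (biprod.inr ≫ p ≫ biprod.snd) (by
    simp only [Category.assoc]
    rw [← hsnd, reassoc_of% hp])
  have hsub : p - biprod.map (e ≫ i) (e' ≫ i') =
      biprod.snd ≫ (biprod.inr ≫ p ≫ biprod.fst) ≫ biprod.inl := by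
    ext <;> simp [hei, hei', hXY]
  exact split_of_sub_comp_sub_eq_zero hp (i := biprod.map i i') (e := biprod.map e e')
    (by ext <;> simp [hie, hie']) (q := biprod.map (e ≫ i) (e' ≫ i'))
    (by ext <;> simp) (by rw [hsub]; simp)

end Idempotents

lemma IsBoundedHereditary.isIdempotentComplete {C : Type u} [Category.{v} C] [HasZeroObject C]
    [HasShift C ℤ] [Preadditive C] [∀ n : ℤ, (shiftFunctor C n).Additive] [Pretriangulated C]
    [IsTriangulated C] {t : TStructure C} (ht : IsBoundedHereditary t)
    (h : ∀ n X, t.IsGE X n → t.IsLE X n → idempotentsSplit X) : IsIdempotentComplete C where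
  idempotents_split := ht.prop_of_biprod (P := idempotentsSplit) h fun n _ _ _ _ =>
    idempotentsSplit_biprod fun f => t.zero f n (n + 1)

section LocalRing

variable {R : Type*} [Ring R]

lemma eq_bot_or_eq_bot_of_isCompl (h : ∀ x : R, IsIdempotentElem x → x = 0 ∨ x = 1) {I J : Ideal R}
    (hIJ : IsCompl I J) : I = ⊥ ∨ J = ⊥ := by
  let p := I.projection J hIJ
  have hp (x : R) : p x = x * p 1 := by rw [← smul_eq_mul, ← map_smul, smul_eq_mul, mul_one]
  have hp₁ : IsIdempotentElem (p 1) := by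
    rw [IsIdempotentElem, ← hp]
    exact Submodule.projection_apply_of_mem_left hIJ (Submodule.projection_apply_mem hIJ 1)
  obtain h₀ | h₁ := h _ hp₁
  · left
    rw [← Submodule.range_projection hIJ, LinearMap.range_eq_bot]
    exact LinearMap.ext_ring h₀
  · right
    rw [← Submodule.ker_projection hIJ, LinearMap.ker_eq_bot']
    intro x hx
    rw [← mul_one x, ← h₁, ← hp, hx]

/-- Apply Fitting's lemma to the multiplication by an element on the right. -/
lemma isLocalRing_of_isArtinianRing [IsArtinianRing R] [Nontrivial R]
    (h : ∀ x : R, IsIdempotentElem x → x = 0 ∨ x = 1) : IsLocalRing R := by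
  refine .of_isUnit_or_isUnit_one_sub_self fun a => ?_
  let f : Module.End R R := LinearMap.toSpanSingleton R R a
  have hf (n : ℕ) (x : R) : (f ^ n) x = x * a ^ n := by
    induction n with
    | zero => simp
    | succ n ih => rw [pow_succ', Module.End.mul_apply, ih, pow_succ, ← mul_assoc]; rfl
  obtain ⟨n, hn, hn₀⟩ := (f.eventually_isCompl_ker_pow_range_pow.and
    (Filter.eventually_ne_atTop 0)).exists
  obtain hker | hrange := eq_bot_or_eq_bot_of_isCompl h hn
  · left
    have hinj : Function.Injective f := by
      obtain ⟨m, rfl⟩ := Nat.exists_eq_succ_of_ne_zero hn₀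
      rw [LinearMap.ker_eq_bot, Nat.succ_eq_add_one, pow_succ] at hker
      exact Function.Injective.of_comp hker
    obtain ⟨b, hb⟩ := IsArtinian.surjective_of_injective_endomorphism f hinj 1
    refine ⟨⟨a, b, hinj ?_, hb⟩, rfl⟩
    simpa [f, mul_assoc] using congrArg (a * ·) hb
  · right
    refine IsNilpotent.isUnit_one_sub ⟨n, ?_⟩
    simpa [hf] using LinearMap.congr_fun (LinearMap.range_eq_bot.1 hrange) 1

end LocalRing

section Indecomposable

variable {C : Type*} [Category* C] [Preadditive C] {X : C}

lemma nontrivial_end_iff : Nontrivial (End X) ↔ ¬ IsZero X := by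
  rw [IsZero.iff_id_eq_zero, ← not_subsingleton_iff_nontrivial, ← subsingleton_iff_zero_eq_one]
  exact not_congr eq_comm

variable [HasBinaryBiproducts C]

lemma exists_iso_biprod_of_comp_self [IsIdempotentComplete C] {p : X ⟶ X} (hp : p ≫ p = p) :
    ∃ (Y Z : C) (α : X ≅ Y ⊞ Z), α.hom ≫ biprod.fst ≫ biprod.inl ≫ α.inv = p := by
  obtain ⟨Y, i, r, hir, hri⟩ := IsIdempotentComplete.idempotents_split X p hp
  obtain ⟨Z, j, s, hjs, hsj⟩ := IsIdempotentComplete.idempotents_split X (𝟙 X - p)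
    (Idempotents.idem_of_id_sub_idem p hp)
  have hi : i ≫ p = i := by rw [← hri, reassoc_of% hir]
  have hj : p ≫ s = 0 := by
    rw [← Category.comp_id s, ← hjs, reassoc_of% hsj, ← Category.assoc]
    simp [hp]
  have his : i ≫ s = 0 := by rw [← hi, Category.assoc, hj, comp_zero]
  have hjr : j ≫ r = 0 := by
    rw [← Category.comp_id r, ← hir, reassoc_of% hri, ← Category.id_comp j, ← hjs]
    simp [reassoc_of% hsj, reassoc_of% hp]
  exact ⟨Y, Z,
    { hom := biprod.lift r s
      inv := biprod.desc i j
      hom_inv_id := by rw [biprod.lift_desc, hri, hsj, add_sub_cancel]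
      inv_hom_id := by ext <;> simp [hir, hjs, his, hjr] }, by simpa using hri⟩

lemma isLocalRing_end_of_indecomposable [IsIdempotentComplete C] [IsArtinianRing (End X)]
    (hX : Indecomposable X) : IsLocalRing (End X) := by
  have := nontrivial_end_iff.2 hX.1
  refine isLocalRing_of_isArtinianRing fun p hp => ?_
  obtain ⟨Y, Z, α, rfl⟩ := exists_iso_biprod_of_comp_self hp
  obtain hY | hZ := hX.2 Y Z α
  · left
    rw [hY.eq_of_src biprod.inl 0, zero_comp, comp_zero, comp_zero]
  · right
    have : biprod.fst ≫ biprod.inl = 𝟙 (Y ⊞ Z) := by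
      rw [← biprod.total, hZ.eq_of_src biprod.inr 0, comp_zero, add_zero]
    rw [reassoc_of% this, α.hom_inv_id]
    rfl

lemma indecomposable_of_isLocalRing_end [IsLocalRing (End X)] : Indecomposable X := by
  refine ⟨nontrivial_end_iff.1 inferInstance, fun Y Z α => ?_⟩
  have hadd : (α.hom ≫ biprod.fst ≫ biprod.inl ≫ α.inv) +
      α.hom ≫ biprod.snd ≫ biprod.inr ≫ α.inv = 𝟙 X := by
    simp_rw [← Preadditive.comp_add, ← Category.assoc biprod.fst, ← Category.assoc biprod.snd,
      ← Preadditive.add_comp, biprod.total, Category.id_comp, α.hom_inv_id]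
  simp_rw [IsZero.iff_id_eq_zero]
  obtain h | h := IsLocalRing.isUnit_or_isUnit_of_add_one (R := End X) hadd
  · right
    have := (isUnit_iff_isIso _).1 h
    have hZ : biprod.inr ≫ α.inv = 0 := by
      rw [← cancel_mono (α.hom ≫ biprod.fst ≫ biprod.inl ≫ α.inv)]
      simp
    simpa using hZ =≫ (α.hom ≫ biprod.snd)
  · left
    have := (isUnit_iff_isIso _).1 h
    have hY : biprod.inl ≫ α.inv = 0 := by
      rw [← cancel_mono (α.hom ≫ biprod.snd ≫ biprod.inr ≫ α.inv)]
      simp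
    simpa using hY =≫ (α.hom ≫ biprod.fst)

end Indecomposable

section Basic

lemma nonempty_biproduct_iso_of_isZero {C : Type*} [Category* C] [Preadditive C]
    [HasFiniteBiproducts C] {n : ℕ} (X : Fin n → C) {p : Fin n → Prop}
    (hp : ∀ i, ¬ p i → IsZero (X i)) :
    ∃ (m : ℕ) (ε : Fin m ≃ Subtype p), Nonempty (⨁ X ≅ ⨁ fun i => X (ε i)) := by
  classical
  refine ⟨_, (Fintype.equivFin (Subtype p)).symm, ⟨?_⟩⟩
  have h : biproduct.map (fun i => if p i then 𝟙 (X i) else 0) = 𝟙 (⨁ X) := by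
    refine biproduct.hom_ext _ _ fun i => ?_
    by_cases hi : p i
    · simp [hi]
    · exact (hp i hi).eq_of_tgt _ _
  exact
    { hom := biproduct.toSubtype X p
      inv := biproduct.fromSubtype X p
      hom_inv_id := (biproduct.toSubtype_fromSubtype X p).trans h } ≪≫
    (biproduct.reindex (Fintype.equivFin (Subtype p)).symm (Subtype.restrict p X)).symm

lemma map_surjective_of_retract {C D : Type*} [Category* C] [Category* D] (L : C ⥤ D)
    {X Y S T : C} (hX : Retract X S) (hY : Retract Y T)
    (h : Function.Surjective (L.map : (S ⟶ T) → _)) :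
    Function.Surjective (L.map : (X ⟶ Y) → _) := by
  intro g
  obtain ⟨f, hf⟩ := h ((hX.map L).r ≫ g ≫ (hY.map L).i)
  refine ⟨hX.i ≫ f ≫ hY.r, ?_⟩
  have hX' := (hX.map L).retract
  have hY' := (hY.map L).retract
  simp only [Retract.map_i, Retract.map_r] at hX' hY' hf
  rw [L.map_comp, L.map_comp, hf, Category.assoc, Category.assoc, hY', Category.comp_id,
    reassoc_of% hX']

section LocalEnd

variable {C D : Type*} [Category* C] [Category* D] [Preadditive C] [Preadditive D] (L : C ⥤ D)
  [L.Additive] {X Y : C}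

lemma isLocalRing_end_map [IsLocalRing (End X)] (hX : ¬ IsZero (L.obj X))
    (hL : Function.Surjective (L.map : (X ⟶ X) → _)) : IsLocalRing (End (L.obj X)) := by
  have := nontrivial_end_iff.2 hX
  refine .of_isUnit_or_isUnit_one_sub_self fun g => ?_
  obtain ⟨f, rfl⟩ := hL g
  refine (IsLocalRing.isUnit_or_isUnit_of_add_one (R := End X) (add_sub_cancel f (𝟙 X))).imp
    (fun h => h.map (L.mapEnd X)) fun h => ?_
  simpa [Functor.mapEnd, End.one_def] using h.map (L.mapEnd X)

lemma isIso_of_map_eq_id [IsLocalRing (End X)] (hX : ¬ IsZero (L.obj X)) {f : X ⟶ X}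
    (hf : L.map f = 𝟙 _) : IsIso f := by
  obtain h | h := IsLocalRing.isUnit_or_isUnit_of_add_one (R := End X) (add_sub_cancel f (𝟙 X))
  · exact (isUnit_iff_isIso _).1 h
  · have := (isUnit_iff_isIso _).1 h
    refine absurd ((IsZero.iff_id_eq_zero _).2 ?_) hX
    rw [← cancel_epi (L.map (𝟙 X - f)), comp_zero, L.map_sub, hf, L.map_id, sub_self, zero_comp]

lemma nonempty_iso_of_map_iso [IsLocalRing (End X)] [IsLocalRing (End Y)]
    (hX : ¬ IsZero (L.obj X)) (hXY : Function.Surjective (L.map : (X ⟶ Y) → _))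
    (hYX : Function.Surjective (L.map : (Y ⟶ X) → _)) (e : L.obj X ≅ L.obj Y) :
    Nonempty (X ≅ Y) := by
  obtain ⟨f, hf⟩ := hXY e.hom
  obtain ⟨g, hg⟩ := hYX e.inv
  have h₁ : IsIso (f ≫ g) := isIso_of_map_eq_id L hX (by simp [hf, hg])
  have h₂ : IsIso (g ≫ f) :=
    isIso_of_map_eq_id L (fun h => hX (h.of_iso e)) (by simp [hf, hg])
  have : IsSplitMono f := ⟨⟨g ≫ inv (f ≫ g), by rw [← Category.assoc, IsIso.hom_inv_id]⟩⟩
  have : Epi f := epi_of_epi g f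
  have : IsIso f := isIso_of_epi_of_isSplitMono f
  exact ⟨asIso f⟩

end LocalEnd

lemma IsBasic.map {C D : Type*} [Category* C] [HasZeroObject C] [HasShift C ℤ] [Preadditive C]
    [∀ n : ℤ, (shiftFunctor C n).Additive] [Pretriangulated C] [Category* D] [HasZeroObject D]
    [HasShift D ℤ] [Preadditive D] [∀ n : ℤ, (shiftFunctor D n).Additive] [Pretriangulated D]
    [IsIdempotentComplete C] [∀ X : C, IsArtinianRing (End X)] (L : C ⥤ D) [L.Additive] {T : C}
    (hL : Function.Surjective (L.map : (T ⟶ T) → _)) (hT : IsBasic T) : IsBasic (L.obj T) := by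
  obtain ⟨n, X, hX, hne, ⟨α⟩⟩ := hT
  have hlocal (i) : IsLocalRing (End (X i)) := isLocalRing_end_of_indecomposable (hX i)
  have hretract (i) : Retract (X i) T :=
    { i := biproduct.ι X i ≫ α.inv
      r := α.hom ≫ biproduct.π X i }
  have hfull (i j) : Function.Surjective (L.map : (X i ⟶ X j) → _) :=
    map_surjective_of_retract L (hretract i) (hretract j) hL
  obtain ⟨m, ε, ⟨β⟩⟩ := nonempty_biproduct_iso_of_isZero (fun i => L.obj (X i))
    (p := fun i => ¬ IsZero (L.obj (X i))) fun _ => not_not.1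
  refine ⟨m, fun i => L.obj (X (ε i)), fun i => ?_, fun i j hij => ⟨fun e => ?_⟩,
    ⟨L.mapIso α ≪≫ L.mapBiproduct X ≪≫ β⟩⟩
  · have := isLocalRing_end_map L (ε i).2 (hfull _ _)
    exact indecomposable_of_isLocalRing_end
  · obtain ⟨e'⟩ := nonempty_iso_of_map_iso L (ε i).2 (hfull _ _) (hfull _ _) e
    exact (hne _ _ (Subtype.val_injective.ne (ε.injective.ne hij))).false e'

end Basic

section Reflector

variable {C C' : Type*} [Category* C] [Category* C'] {F : C' ⥤ C}

lemma isRightAdjoint_of_forall_exists_isLocal [F.Full] [F.Faithful]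
    (h : ∀ X, ∃ (X' : C) (p : X ⟶ X'), F.essImage X' ∧ F.essImage.isLocal p) :
    F.IsRightAdjoint := by
  rw [Functor.isRightAdjoint_iff_leftAdjointObjIsDefined_eq_top, eq_top_iff]
  intro X _
  obtain ⟨X', p, ⟨Z, ⟨e⟩⟩, hp⟩ := h X
  have hq : F.essImage.isLocal (p ≫ e.inv) :=
    MorphismProperty.comp_mem _ _ _ hp (ObjectProperty.isLocal_of_isIso _ _)
  exact Functor.CorepresentableBy.isCorepresentable
    { homEquiv := fun {Y} => (Functor.FullyFaithful.ofFullyFaithful F).homEquiv.trans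
        (Equiv.ofBijective _ (hq _ (F.obj_mem_essImage Y)))
      homEquiv_comp := fun _ _ => by simp [Functor.FullyFaithful.homEquiv] }

variable {L : C ⥤ C'} (adj : L ⊣ F)
include adj

lemma isLocal_essImage_unit_app [F.Full] [F.Faithful] (X : C) :
    F.essImage.isLocal (adj.unit.app X) := by
  rw [← F.isoClosure_eq_essImage, ObjectProperty.isoClosure_isLocal]
  exact ObjectProperty.isLocal_adj_unit_app adj X

lemma map_surjective_of_lift {X Y : C}
    (h : ∀ g : X ⟶ F.obj (L.obj Y), ∃ g', g' ≫ adj.unit.app Y = g) :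
    Function.Surjective (L.map : (X ⟶ Y) → _) := by
  intro g
  obtain ⟨f, hf⟩ := h (adj.homEquiv _ _ g)
  exact ⟨f, (adj.homEquiv _ _).injective (by rw [← hf, adj.homEquiv_unit, adj.unit_naturality])⟩

variable [Preadditive C] [Preadditive C']

lemma map_eq_zero_iff_comp_unit_eq_zero [F.PreservesZeroMorphisms] {X Y : C} (f : X ⟶ Y) :
    L.map f = 0 ↔ f ≫ adj.unit.app Y = 0 := by
  rw [← (adj.homEquiv _ _).injective.eq_iff, adj.homEquiv_unit, adj.homEquiv_unit,
    adj.unit_naturality, F.map_zero, comp_zero]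

lemma leftAdjoint_linear (k : Type*) [Semiring k] [Linear k C] [Linear k C'] [F.Linear k] :
    L.Linear k where
  map_smul f a := (adj.homEquiv _ _).injective (by
    simp only [adj.homEquiv_unit, F.map_smul, Linear.comp_smul, adj.unit_naturality,
      Linear.smul_comp])

lemma hom_obj_shift_eq_zero_iff [HasShift C ℤ] [HasShift C' ℤ] [F.CommShift ℤ]
    (X : C) (Y : C') (n : ℤ) :
    (∀ f : L.obj X ⟶ Y⟦n⟧, f = 0) ↔ ∀ f : X ⟶ (F.obj Y)⟦n⟧, f = 0 :=
  forall_hom_eq_zero_congr ((adj.homEquiv _ _).trans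
    ((Iso.refl X).homCongr ((F.commShiftIso n).app Y)))

end Reflector

section Algebra

variable {k A B : Type*} [CommSemiring k] [Ring A] [Algebra k A] [Ring B] [Algebra k B]

lemma nonempty_quotient_algEquiv_of_ker_eq {I : TwoSidedIdeal A} (f : A →ₐ[k] B)
    (hf : Function.Surjective f) (hI : TwoSidedIdeal.ker f = I) :
    Nonempty (I.ringCon.Quotient ≃ₐ[k] B) := by
  have h : I.ringCon = RingCon.ker (f : A →+* B) := by
    rw [← hI]
    rfl
  exact ⟨AlgEquiv.ofBijective (I.ringCon.liftₐ f h.le) (RingCon.lift_bijective_iff.2 ⟨h, hf⟩)⟩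

lemma comap_span_singleton (φ : A ≃ₐ[k] B) (a : A) :
    TwoSidedIdeal.comap φ (TwoSidedIdeal.span {φ a}) = TwoSidedIdeal.span {a} := by
  refine le_antisymm (fun x hx => ?_) ?_
  · have h : TwoSidedIdeal.span {φ a} ≤ TwoSidedIdeal.comap φ.symm (TwoSidedIdeal.span {a}) := by
      simpa [TwoSidedIdeal.span_le, TwoSidedIdeal.mem_comap] using
        TwoSidedIdeal.subset_span (Set.mem_singleton a)
    simpa [TwoSidedIdeal.mem_comap] using h (TwoSidedIdeal.mem_comap φ |>.1 hx)
  · simpa [TwoSidedIdeal.span_le, TwoSidedIdeal.mem_comap] using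
      TwoSidedIdeal.subset_span (Set.mem_singleton (φ a))

lemma nonempty_idemQuotient_congr (φ : A ≃ₐ[k] B) (a : A) :
    Nonempty (IdemQuotient a ≃ₐ[k] IdemQuotient (φ a)) :=
  ⟨RingCon.congrₐ k φ (congrArg TwoSidedIdeal.ringCon (comap_span_singleton φ a).symm)⟩

end Algebra

section Reduction

section Retract

variable {C : Type*} [Category* C] [Preadditive C]

lemma hom_eq_zero_of_retract {X Y X' Y' : C} (h : ∀ f : X ⟶ Y, f = 0) (rX : Retract X' X)
    (rY : Retract Y' Y) (f : X' ⟶ Y') : f = 0 := by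
  rw [← Category.id_comp f, ← Category.comp_id f, ← rX.retract, ← rY.retract]
  simpa using rX.i ≫= h (rX.r ≫ f ≫ rY.i) =≫ rY.r

/-- The idempotent endomorphism of `T` cutting out the direct summand `D`. -/
def retractIdempotent {T D : C} (r : Retract D T) : End T :=
  r.r ≫ r.i

lemma mem_span_of_mem_homsThrough {T D : C} (r : Retract D T) {f : End T}
    (hf : f ∈ homsThrough D T T) : f ∈ TwoSidedIdeal.span {retractIdempotent r} := by
  let I := TwoSidedIdeal.span {retractIdempotent r}
  refine homsThrough_le (S := (AddSubgroup.ofClass I : AddSubgroup (End T))).2 (fun x y => ?_) hf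
  have hxy : x ≫ y = End.of (r.r ≫ y) * retractIdempotent r * End.of (x ≫ r.i) := by
    simp [retractIdempotent, End.mul_def]
  exact hxy ▸ I.mul_mem_right _ _ (I.mul_mem_left _ _ (TwoSidedIdeal.subset_span rfl))

end Retract

variable {C C' : Type*} [Category* C] [Preadditive C] [HasShift C ℤ] [Category* C']
  [Preadditive C']

section

variable {F : C' ⥤ C} {L : C ⥤ C'} (adj : L ⊣ F) {T D : C}
include adj

lemma IsPresilting.obj [HasShift C' ℤ] [F.CommShift ℤ] (hT : IsPresilting T)
    (hD : ∀ s > (0 : ℤ), ∀ f : T ⟶ D⟦s⟧, f = 0) (h : IsApproximation D 0 (adj.unit.app T)) :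
    IsPresilting (L.obj T) := by
  intro n hn
  rw [hom_obj_shift_eq_zero_iff adj, ← neg_neg n, ← shift_hom_eq_zero_iff]
  intro f
  obtain ⟨g, rfl⟩ := h.exists_lift (fun s hs =>
    (shift_hom_shift_eq_zero_iff (c := n + s) (by lia)).2 (hD (n + s) (by lia))) f
  have hg : g = 0 := (shift_hom_eq_zero_iff (-n)).2 (hT (- -n) (by lia)) g
  rw [hg, zero_comp]

lemma ker_eq_span_retractIdempotent [F.Additive] (r : Retract D T)
    (hF : F.essImage ≤ shiftPerp D) (hD : ∀ s > (0 : ℤ), ∀ f : T ⟶ D⟦s⟧, f = 0)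
    (h : IsApproximation D 0 (adj.unit.app T)) {k : Type*} [CommSemiring k] [Linear k C]
    [Linear k C'] (Φ : End T →ₐ[k] End (L.obj T)) (hΦ : ∀ f : End T, Φ f = L.map f) :
    TwoSidedIdeal.ker Φ = TwoSidedIdeal.span {retractIdempotent r} := by
  refine le_antisymm (fun f hf => ?_) ?_
  · rw [TwoSidedIdeal.mem_ker, hΦ] at hf
    exact mem_span_of_mem_homsThrough r (homsThrough_le_of_iso ((shiftFunctorZero C ℤ).app D) _ _
      (h.mem_homsThrough hD f ((map_eq_zero_iff_comp_unit_eq_zero adj f).1 hf)))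
  · rw [TwoSidedIdeal.span_le, Set.singleton_subset_iff]
    refine (TwoSidedIdeal.mem_ker Φ).2 ((hΦ _).trans ?_)
    have hi : r.i ≫ adj.unit.app T = 0 :=
      (forall_hom_eq_zero_congr ((Iso.refl D).homCongr ((shiftFunctorZero C ℤ).app _))).1
        (hF _ (F.obj_mem_essImage _) 0) _
    refine (map_eq_zero_iff_comp_unit_eq_zero adj _).2 ?_
    rw [retractIdempotent, Category.assoc, hi, comp_zero]

end

variable [HasZeroObject C] [∀ n : ℤ, (shiftFunctor C n).Additive] [Pretriangulated C]
  [HasZeroObject C'] [HasShift C' ℤ] [∀ n : ℤ, (shiftFunctor C' n).Additive] [Pretriangulated C']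
  [IsTriangulated C']

lemma triangEnvelope_obj_eq_top (L : C ⥤ C') [L.CommShift ℤ] [L.IsTriangulated] [L.EssSurj]
    {T : C} (hT : (ObjectProperty.singleton T).triangEnvelope = ⊤) :
    (ObjectProperty.singleton (L.obj T)).triangEnvelope = ⊤ := by
  let Q := (ObjectProperty.singleton (L.obj T)).triangEnvelope
  have : (Q.inverseImage L).IsStableUnderRetracts :=
    ⟨fun r h => Q.prop_of_retract (r.map L) h⟩
  have hQ : (ObjectProperty.singleton T).triangEnvelope ≤ Q.inverseImage L := by
    rw [ObjectProperty.triangEnvelope_le_iff]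
    rintro _ ⟨⟩
    exact ObjectProperty.le_triangEnvelope _ _ (by simp)
  rw [eq_top_iff]
  exact fun Y _ => Q.prop_of_iso (L.objObjPreimageIso Y) (hQ _ (hT ▸ trivial))

variable {F : C' ⥤ C} [F.Full] [F.Faithful] [F.CommShift ℤ] [F.IsTriangulated]

theorem exists_silting_reduction [IsIdempotentComplete C] {t : TStructure C}
    (ht : IsBoundedHereditary t) (k : Type*) [Field k] [Linear k C] [Linear k C'] [F.Linear k]
    [∀ X Y : C, Module.Finite k (X ⟶ Y)] {T D : C}
    (hT : IsSilting T) (r : Retract D T) (hF : F.essImage = shiftPerp D) :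
    ∃ T' : C', IsSilting T' ∧ (IsBasic T → IsBasic T') ∧
      (∀ (Y : C') (n : ℤ), (∀ f : T ⟶ (F.obj Y)⟦n⟧, f = 0) → ∀ f : T' ⟶ Y⟦n⟧, f = 0) ∧
      Nonempty (IdemQuotient (retractIdempotent r) ≃ₐ[k] End T') := by
  have hD : IsPresilting D := fun n hn =>
    hom_eq_zero_of_retract (hT.1 n hn) r (r.map (shiftFunctor C n))
  have hTD : ∀ s > (0 : ℤ), ∀ f : T ⟶ D⟦s⟧, f = 0 := fun n hn =>
    hom_eq_zero_of_retract (hT.1 n hn) (.refl T) (r.map (shiftFunctor C n))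
  have hDT : ∀ s < (0 : ℤ), ∀ f : D⟦s⟧ ⟶ T, f = 0 := fun s hs =>
    (shift_hom_eq_zero_iff s).2 (hom_eq_zero_of_retract (hT.1 (-s) (by lia)) r (.refl _))
  have : F.IsRightAdjoint := isRightAdjoint_of_forall_exists_isLocal fun X => by
    obtain ⟨s₀, hs₀⟩ := ht.exists_forall_lt_hom_eq_zero D X
    obtain ⟨X', p, hX', hp⟩ := ht.exists_isApproximation k hD hs₀
    exact ⟨X', p, hF ▸ hX', hF ▸ hp.isLocal⟩
  let L := F.leftAdjoint
  let adj : L ⊣ F := .ofIsRightAdjoint F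
  let _ : L.CommShift ℤ := adj.leftAdjointCommShift ℤ
  have : adj.CommShift ℤ := adj.commShift_of_rightAdjoint ℤ
  have : L.IsTriangulated := adj.isTriangulated_leftAdjoint
  have : L.Linear k := leftAdjoint_linear adj k
  have : L.EssSurj := ⟨fun Y => ⟨F.obj Y, ⟨asIso (adj.counit.app Y)⟩⟩⟩
  obtain ⟨X', p, hX', hp⟩ := ht.exists_isApproximation k hD hDT
  have hη : IsApproximation D 0 (adj.unit.app T) :=
    hp.of_isLocal hX' (hF ▸ isLocal_essImage_unit_app adj T) (hF ▸ F.obj_mem_essImage _)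
  have hsurj : Function.Surjective (L.map : (T ⟶ T) → _) :=
    map_surjective_of_lift adj fun g => hη.exists_lift hTD g
  have (X : C) : IsArtinianRing (End X) :=
    have : Module.Finite k (End X) := inferInstanceAs (Module.Finite k (X ⟶ X))
    .of_finite k (End X)
  let Φ : End T →ₐ[k] End (L.obj T) := AlgHom.ofLinearMap (L.mapLinearMap k) (L.map_id T)
    fun f g => L.map_comp g f
  exact ⟨L.obj T, ⟨hT.1.obj adj hTD hη, triangEnvelope_obj_eq_top L hT.2⟩, IsBasic.map L hsurj,
    fun Y n => (hom_obj_shift_eq_zero_iff adj T Y n).2, nonempty_quotient_algEquiv_of_ker_eq Φ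
      hsurj (ker_eq_span_retractIdempotent adj r hF.le hTD hη Φ fun _ => rfl)⟩

end Reduction

section HomExact

variable {C : Type u} [Category.{v} C] [Preadditive C] [HasZeroObject C] [HasShift C ℤ]
  [∀ n : ℤ, (shiftFunctor C n).Additive] [Pretriangulated C] {T : Triangle C}

lemma rightComp_exact (hT : T ∈ distTriang C) (X : C) :
    Function.Exact (Preadditive.rightComp X T.mor₁) (Preadditive.rightComp X T.mor₂) :=
  fun f => ⟨fun hf => (T.coyoneda_exact₂ hT f hf).imp fun _ h => h.symm, by
    rintro ⟨g, rfl⟩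
    exact (Category.assoc ..).trans (by rw [comp_distTriang_mor_zero₁₂ _ hT, comp_zero])⟩

lemma leftComp_exact (hT : T ∈ distTriang C) (Y : C) :
    Function.Exact (Preadditive.leftComp Y T.mor₂) (Preadditive.leftComp Y T.mor₁) :=
  fun f => ⟨fun hf => (T.yoneda_exact₂ hT f hf).imp fun _ h => h.symm, by
    rintro ⟨g, rfl⟩
    exact (comp_distTriang_mor_zero₁₂_assoc _ hT _).trans zero_comp⟩

end HomExact

section Effaceable

universe w

variable {H : Type u} [Category.{v} H] [Abelian H]

lemma exists_hom_from_single_isIso_f (K : CochainComplex H ℤ) [K.IsStrictlyLE 0] :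
    ∃ j : (CochainComplex.singleFunctor H 0).obj (K.X 0) ⟶ K, IsIso (j.f 0) := by
  refine ⟨HomologicalComplex.mkHomFromSingle (𝟙 _) fun i hi => ?_, ?_⟩
  · exact (K.isZero_of_isStrictlyLE 0 i (by simp_all; lia)).eq_of_tgt _ _
  · rw [HomologicalComplex.mkHomFromSingle_f, Category.comp_id]
    exact inferInstanceAs (IsIso (HomologicalComplex.singleObjXSelf ..).hom)

lemma epi_of_map_eq_comp_of_isIso_Q_map {K : CochainComplex H ℤ} {Z M : H} {p : Z ⟶ M}
    {j : (CochainComplex.singleFunctor H 0).obj Z ⟶ K} [IsIso (j.f 0)]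
    {s : K ⟶ (CochainComplex.singleFunctor H 0).obj M} [IsIso (DerivedCategory.Q.map s)]
    (hp : (CochainComplex.singleFunctor H 0).map p = j ≫ s) : Epi p := by
  let S := CochainComplex.singleFunctor H 0
  have : (S ⋙ DerivedCategory.Q).Faithful :=
    inferInstanceAs (DerivedCategory.singleFunctor H 0).Faithful
  refine (Preadditive.epi_iff_cancel_zero p).2 fun A h hph => ?_
  have hjs : j ≫ s ≫ S.map h = 0 := by
    rw [← Category.assoc, ← hp, ← Functor.map_comp, hph, Functor.map_zero]
  have hs₀ : (s ≫ S.map h).f 0 = 0 := by simpa using HomologicalComplex.congr_hom hjs 0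
  have hs : s ≫ S.map h = 0 := HomologicalComplex.to_single_hom_ext hs₀
  apply (S ⋙ DerivedCategory.Q).map_injective
  rw [← cancel_epi (DerivedCategory.Q.map s), Functor.map_zero, comp_zero, Functor.comp_map,
    ← Functor.map_comp, hs, Functor.map_zero]

/-- Represent `f` by a roof over a quasi-isomorphism `K ⟶ M` with `K` concentrated in nonpositive
degrees: the epimorphism is `K.X 0 ⟶ M`. -/
lemma exists_epi_Q_map_comp_eq_zero {M : H} {L : CochainComplex H ℤ} (hL : IsZero (L.X 0))
    (f : DerivedCategory.Q.obj ((CochainComplex.singleFunctor H 0).obj M) ⟶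
      DerivedCategory.Q.obj L) :
    ∃ (Z : H) (p : Z ⟶ M), Epi p ∧
      DerivedCategory.Q.map ((CochainComplex.singleFunctor H 0).map p) ≫ f = 0 := by
  obtain ⟨K, _, s, _, g, rfl⟩ := DerivedCategory.right_fac_of_isStrictlyLE f 0
  obtain ⟨j, _⟩ := exists_hom_from_single_isIso_f K
  obtain ⟨p, hp⟩ := (CochainComplex.singleFunctor H 0).map_surjective (j ≫ s)
  have hjg : j ≫ g = 0 := HomologicalComplex.from_single_hom_ext (hL.eq_of_tgt _ _)
  refine ⟨K.X 0, p, epi_of_map_eq_comp_of_isIso_Q_map hp, ?_⟩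
  rw [hp, Functor.map_comp, Category.assoc, IsIso.hom_inv_id_assoc, ← Functor.map_comp, hjg,
    Functor.map_zero]

lemma exists_epi_map_comp_eq_zero {M N : H} {m : ℤ} (hm : m < 0)
    (f : (DerivedCategory.singleFunctor H 0).obj M ⟶ (DerivedCategory.singleFunctor H m).obj N) :
    ∃ (Z : H) (p : Z ⟶ M), Epi p ∧ (DerivedCategory.singleFunctor H 0).map p ≫ f = 0 :=
  exists_epi_Q_map_comp_eq_zero (HomologicalComplex.isZero_single_obj_X _ m N 0 hm.ne') f

variable [HasExt.{w} H]

lemma exists_epi_mk₀_comp_eq_zero {M N : H} {n : ℕ} (hn : 0 < n) (ξ : Ext.{w} M N n) :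
    ∃ (Z : H) (p : Z ⟶ M), Epi p ∧ (Ext.mk₀ p).comp ξ (zero_add n) = 0 := by
  let e := ((DerivedCategory.singleFunctors H).shiftIso (n : ℤ) (-n) 0 (by simp)).app N
  obtain ⟨Z, p, hp, h⟩ := exists_epi_map_comp_eq_zero (by lia) (ξ.hom ≫ e.hom)
  refine ⟨Z, p, hp, ?_⟩
  ext
  rw [← Ext.singleFunctor_map_comp_hom, Ext.zero_hom]
  exact (cancel_mono e.hom).1 (((Category.assoc ..).trans h).trans zero_comp.symm)

lemma exists_extClass_comp {M N : H} {n m : ℕ} (hm : 1 + n = m) (ξ : Ext.{w} M N m) :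
    ∃ (K Z : H) (i : K ⟶ Z) (p : Z ⟶ M) (w : i ≫ p = 0) (hS : (ShortComplex.mk i p w).ShortExact)
      (η : Ext.{w} K N n), hS.extClass.comp η hm = ξ := by
  obtain ⟨Z, p, hp, h⟩ := exists_epi_mk₀_comp_eq_zero (by lia) ξ
  have hS : (ShortComplex.mk _ _ (kernel.condition p)).ShortExact :=
    { exact := ShortComplex.exact_kernel p }
  obtain ⟨η, hη⟩ := Ext.contravariant_sequence_exact₃ hS N ξ h hm
  exact ⟨_, _, _, _, _, hS, η, hη⟩

lemma subsingleton_ext_of_le {n : ℕ} (h : ∀ X Y : H, Subsingleton (Ext.{w} X Y n)) (X Y : H)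
    {m : ℕ} (hm : n ≤ m) : Subsingleton (Ext.{w} X Y m) := by
  induction m, hm using Nat.le_induction generalizing X with
  | base => exact h X Y
  | succ m _ ih =>
    refine subsingleton_of_forall_eq 0 fun ξ => ?_
    obtain ⟨K, Z, i, p, w, hS, η, rfl⟩ := exists_extClass_comp (add_comm 1 m) ξ
    rw [(ih K).elim η 0, Ext.comp_zero]

end Effaceable

section ExtComparison

universe w w' v' u'

variable {H : Type u} [Category.{v} H] [Abelian H]

lemma shortExact_pushout {K Z M N : H} {i : K ⟶ Z} {p : Z ⟶ M} {w : i ≫ p = 0}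
    (hS : (ShortComplex.mk i p w).ShortExact) (g : K ⟶ N) :
    (ShortComplex.mk (pushout.inr i g) (pushout.desc p 0 (w.trans comp_zero.symm))
      (pushout.inr_desc _ _ _)).ShortExact := by
  have : Mono i := hS.mono_f
  have : Epi p := hS.epi_g
  have h : i ≫ p = g ≫ 0 := w.trans comp_zero.symm
  have : Epi (pushout.desc p 0 h) := epi_of_epi_fac (pushout.inl_desc p 0 h)
  refine { exact := ?_ }
  refine ShortComplex.exact_of_g_is_cokernel _
    (CokernelCofork.IsColimit.ofπ' _ _ fun {A} k hk => ?_)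
  have h₀ : i ≫ pushout.inl i g ≫ k = 0 := by
    rw [pushout.condition_assoc]
    exact (congrArg _ hk).trans comp_zero
  refine ⟨hS.exact.desc (pushout.inl i g ≫ k) h₀, pushout.hom_ext ?_ ?_⟩
  · rw [pushout.inl_desc_assoc]
    exact hS.exact.g_desc _ _
  · rw [pushout.inr_desc_assoc, zero_comp]
    exact hk.symm

lemma exists_extClass_eq [HasExt.{w} H] {M N : H} (ξ : Ext.{w} M N 1) :
    ∃ (E : H) (i : N ⟶ E) (p : E ⟶ M) (w : i ≫ p = 0)
      (hS : (ShortComplex.mk i p w).ShortExact), hS.extClass = ξ := by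
  obtain ⟨K, Z, i, p, w, hS, η, rfl⟩ := exists_extClass_comp (n := 0) rfl ξ
  obtain ⟨g, rfl⟩ := (Ext.mk₀_bijective _ _).2 η
  have h := ShortComplex.ShortExact.extClass_naturality hS (shortExact_pushout hS g)
    { τ₁ := g, τ₂ := pushout.inl i g, τ₃ := 𝟙 M
      comm₁₂ := pushout.condition.symm
      comm₂₃ := (pushout.inl_desc _ _ _).trans (Category.comp_id _).symm }
  exact ⟨_, _, _, _, shortExact_pushout hS g, (h.trans (Ext.mk₀_id_comp _)).symm⟩

variable {W : Type u'} [Category.{v'} W] [Abelian W] (F : W ⥤ H) [F.Full]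

lemma exists_preimage_of_shortExact [F.PreservesZeroMorphisms] [F.Faithful]
    [F.essImage.IsClosedUnderExtensions] {M N : W} {E : H} {i : F.obj N ⟶ E} {p : E ⟶ F.obj M}
    {w : i ≫ p = 0} (hS : (ShortComplex.mk i p w).ShortExact) :
    ∃ (E' : W) (i' : N ⟶ E') (p' : E' ⟶ M) (_ : i' ≫ p' = 0) (e : F.obj E' ≅ E),
      F.map i' ≫ e.hom = i ∧ F.map p' = e.hom ≫ p := by
  obtain ⟨E', ⟨e : F.obj E' ≅ E⟩⟩ := F.essImage.prop_X₂_of_shortExact hS (F.obj_mem_essImage N)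
    (F.obj_mem_essImage M)
  obtain ⟨i', hi'⟩ := F.map_surjective (i ≫ e.inv)
  obtain ⟨p', hp'⟩ := F.map_surjective (e.hom ≫ p)
  exact ⟨E', i', p', F.map_injective (by simp [hi', hp', w]), e, by simp [hi'], hp'⟩

variable [F.Additive] [PreservesFiniteLimits F] [PreservesFiniteColimits F] [F.Faithful]
  [HasExt.{w} H] [HasExt.{w'} W]

lemma mapExtAddHom_zero_bijective (M N : W) :
    Function.Bijective (F.mapExtAddHom M N 0 : Ext.{w'} M N 0 →+ Ext.{w} _ _ 0) := by
  simpa [Ext.mapExactFunctor₀] using ⟨F.map_injective, F.map_surjective⟩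

omit [F.Full] [F.Faithful] in
lemma mapExtAddHom_succ_injective {n : ℕ} (hn : ∀ M N : W,
      Function.Bijective (F.mapExtAddHom M N n : Ext.{w'} M N n →+ Ext.{w} _ _ n)) (M N : W) :
    Function.Injective (F.mapExtAddHom M N (n + 1) :
      Ext.{w'} M N (n + 1) →+ Ext.{w} _ _ (n + 1)) := by
  refine (injective_iff_map_eq_zero _).2 fun ξ hξ => ?_
  obtain ⟨K, Z, i, p, w, hS, η, rfl⟩ := exists_extClass_comp (add_comm 1 n) ξ
  rw [Functor.mapExtAddHom_apply, Ext.mapExactFunctor_comp, Ext.mapExactFunctor_extClass] at hξ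
  obtain ⟨y, hy⟩ := Ext.contravariant_sequence_exact₁ (hS.map_of_exact F) _ _ _ hξ
  obtain ⟨y, rfl⟩ := (hn Z N).2 y
  obtain rfl : (Ext.mk₀ i).comp y (zero_add n) = η := by
    apply (hn K N).1
    rw [Functor.mapExtAddHom_apply, Ext.mapExactFunctor_comp, Ext.mapExactFunctor_mk₀]
    exact hy
  exact hS.extClass_comp_assoc y

lemma mapExtAddHom_one_surjective [F.essImage.IsClosedUnderExtensions] (M N : W) :
    Function.Surjective (F.mapExtAddHom M N 1 : Ext.{w'} M N 1 →+ Ext.{w} _ _ 1) := by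
  intro ξ
  obtain ⟨E, i, p, w, hS, rfl⟩ := exists_extClass_eq ξ
  obtain ⟨E', i', p', w', e, hi, hp⟩ := exists_preimage_of_shortExact F hS
  let φ : (ShortComplex.mk i' p' w').map F ≅ ShortComplex.mk i p w :=
    ShortComplex.isoMk (Iso.refl _) e (Iso.refl _) ((Category.id_comp i).trans hi.symm)
      (hp.symm.trans (Category.comp_id _).symm)
  have hS' := (ShortExact.shortExact_map_iff F).1 (ShortComplex.shortExact_of_iso φ.symm hS)
  refine ⟨hS'.extClass, ?_⟩
  rw [Functor.mapExtAddHom_apply, Ext.mapExactFunctor_extClass]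
  have h := ShortComplex.ShortExact.extClass_naturality (hS'.map_of_exact F) hS φ.hom
  exact (Ext.comp_mk₀_id _).symm.trans (h.trans (Ext.mk₀_id_comp _))

end ExtComparison

attribute [local instance] HasExt.standard

section Devissage

open DerivedCategory DerivedCategory.TStructure

variable {H : Type u} [Category.{v} H] [Abelian H]

lemma exists_iso_singleFunctor_obj_shift (X : DerivedCategory H) (n : ℤ) [X.IsGE n] [X.IsLE n] :
    ∃ M : H, Nonempty (X ≅ ((singleFunctor H 0).obj M)⟦-n⟧) := by
  obtain ⟨M, ⟨e⟩⟩ := exists_iso_singleFunctor_obj_of_isGE_of_isLE X n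
  exact ⟨M, ⟨e ≪≫ (((singleFunctors H).shiftIso (-n) n 0 (by simp)).app M).symm⟩⟩

lemma bounded_singleFunctor_obj (M : H) (n : ℤ) :
    (t : TStructure (DerivedCategory H)).bounded ((singleFunctor H n).obj M) :=
  ⟨⟨n, inferInstanceAs (((singleFunctor H n).obj M).IsGE n)⟩,
    ⟨n, inferInstanceAs (((singleFunctor H n).obj M).IsLE n)⟩⟩

lemma bounded_le {P : ObjectProperty (DerivedCategory H)} [P.IsTriangulatedClosed₂]
    [P.IsClosedUnderIsomorphisms] (h : ∀ (M : H) (n : ℤ), P (((singleFunctor H 0).obj M)⟦n⟧)) :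
    t.bounded ≤ P := by
  rintro X ⟨⟨a, ha⟩, ⟨b, hb⟩⟩
  refine prop_of_isGE_of_isLE (min_le_right a b) (fun n _ _ Y _ _ => ?_)
    (t.isGE_of_ge X (min a b) a (min_le_left a b)) hb
  obtain ⟨M, ⟨e⟩⟩ := exists_iso_singleFunctor_obj_shift Y n
  exact P.prop_of_iso e.symm (h M (-n))

lemma singleFunctor_hom_shift_eq_zero_of_neg {M N : H} {m : ℤ} (hm : m < 0)
    (f : (singleFunctor H 0).obj M ⟶ ((singleFunctor H 0).obj N)⟦m⟧) : f = 0 :=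
  have := t.isGE_shift ((singleFunctor H 0).obj N) 0 m (-m)
  t.zero f 0 (-m)

variable (H) in
/-- The standard t-structure on the bounded derived category. -/
noncomputable abbrev tBounded : TStructure (Bounded H) := t.bounded.tStructure t

lemma exists_iso_lift_singleFunctor_obj {X : Bounded H} {n : ℤ} (hn : (tBounded H).IsGE X n)
    (hn' : (tBounded H).IsLE X n) :
    ∃ M : H, Nonempty (X ≅ (t.bounded.lift (singleFunctor H n)
      fun M => bounded_singleFunctor_obj M n).obj M) := by
  have : X.obj.IsGE n := (ObjectProperty.tStructure_isGE_iff ..).1 hn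
  have : X.obj.IsLE n := (ObjectProperty.tStructure_isLE_iff ..).1 hn'
  obtain ⟨M, ⟨e⟩⟩ := exists_iso_singleFunctor_obj_of_isGE_of_isLE X.obj n
  exact ⟨M, ⟨t.bounded.fullyFaithfulι.preimageIso e⟩⟩

end Devissage

section FiniteDimensional

variable (k : Type*) [Field k]

section

variable {C : Type u} [Category.{v} C] [Preadditive C] [Linear k C]

/-- The objects `X` such that `Hom(X, Y)` is finite-dimensional. -/
def finiteHomTo (Y : C) : ObjectProperty C := fun X => Module.Finite k (X ⟶ Y)

/-- The objects `Y` such that `Hom(X, Y)` is finite-dimensional. -/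
def finiteHomFrom (X : C) : ObjectProperty C := fun Y => Module.Finite k (X ⟶ Y)

instance (Y : C) : (finiteHomTo k Y).IsClosedUnderIsomorphisms where
  of_iso e (_ : Module.Finite k _) := Module.Finite.equiv (Linear.homCongr k e (Iso.refl Y))

instance (X : C) : (finiteHomFrom k X).IsClosedUnderIsomorphisms where
  of_iso e (_ : Module.Finite k _) := Module.Finite.equiv (Linear.homCongr k (Iso.refl X) e)

lemma finite_shift_hom_shift [HasShift C ℤ] [∀ n : ℤ, (shiftFunctor C n).Additive]
    [∀ n : ℤ, (shiftFunctor C n).Linear k] {X Y : C} {a b c : ℤ} (hc : c + a = b)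
    [Module.Finite k (X ⟶ Y⟦c⟧)] : Module.Finite k (X⟦a⟧ ⟶ Y⟦b⟧) :=
  (finiteHomFrom k _).prop_of_iso ((shiftFunctorAdd' C c a b hc).symm.app Y)
    (Module.Finite.of_surjective ((shiftFunctor C a).mapLinearMap k (X := X) (Y := Y⟦c⟧))
      (Functor.map_surjective _))

variable [HasZeroObject C] [HasShift C ℤ] [∀ n : ℤ, (shiftFunctor C n).Additive]
  [Pretriangulated C]

instance (Y : C) : (finiteHomTo k Y).IsTriangulatedClosed₂ := .mk' fun T hT h₁ h₃ => by
  have : Module.Finite k (T.obj₁ ⟶ Y) := h₁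
  have : Module.Finite k (T.obj₃ ⟶ Y) := h₃
  have := isNoetherian_of_range_eq_ker (Linear.leftComp k Y T.mor₂) (Linear.leftComp k Y T.mor₁)
    (LinearMap.exact_iff.1 (leftComp_exact hT Y)).symm
  exact (inferInstance : Module.Finite k (T.obj₂ ⟶ Y))

instance (X : C) : (finiteHomFrom k X).IsTriangulatedClosed₂ := .mk' fun T hT h₁ h₃ => by
  have : Module.Finite k (X ⟶ T.obj₁) := h₁
  have : Module.Finite k (X ⟶ T.obj₃) := h₃
  have := isNoetherian_of_range_eq_ker (Linear.rightComp k X T.mor₁) (Linear.rightComp k X T.mor₂)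
    (LinearMap.exact_iff.1 (rightComp_exact hT X)).symm
  exact (inferInstance : Module.Finite k (X ⟶ T.obj₂))

end

open DerivedCategory DerivedCategory.TStructure

variable {H : Type u} [Category.{v} H] [Abelian H] [Linear k H]

lemma finite_singleFunctor_hom_shift
    (h : ∀ (M N : H) (n : ℕ), Module.Finite k (Ext.{max u v} M N n)) (M N : H) (m : ℤ) :
    Module.Finite k ((singleFunctor H 0).obj M ⟶ ((singleFunctor H 0).obj N)⟦m⟧) := by
  obtain ⟨n, rfl⟩ | hm : (∃ n : ℕ, m = n) ∨ m < 0 := by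
    rcases le_or_gt 0 m with hm | hm
    exacts [.inl ⟨m.toNat, by lia⟩, .inr hm]
  · have := h M N n
    exact Module.Finite.equiv (Ext.homLinearEquiv (R := k))
  · have := subsingleton_of_forall_eq 0
      (singleFunctor_hom_shift_eq_zero_of_neg (M := M) (N := N) hm)
    infer_instance

lemma finite_bounded_hom (h : ∀ (M N : H) (n : ℕ), Module.Finite k (Ext.{max u v} M N n))
    (X Y : Bounded H) : Module.Finite k (X ⟶ Y) := by
  have hXY : Module.Finite k (Bounded.ι.obj X ⟶ Bounded.ι.obj Y) := by
    refine bounded_le (P := finiteHomTo k _) (fun M n => ?_) _ X.property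
    refine bounded_le (P := finiteHomFrom k _) (fun N m => ?_) _ Y.property
    have := finite_singleFunctor_hom_shift k h M N (m - n)
    exact finite_shift_hom_shift k (sub_add_cancel m n)
  exact Module.Finite.of_injective (Bounded.ι.mapLinearMap k (X := X) (Y := Y))
    Bounded.ι.map_injective

end FiniteDimensional

section Hereditary

open DerivedCategory DerivedCategory.TStructure

variable {H : Type u} [Category.{v} H] [Abelian H]

variable (H) in
/-- An abelian category is hereditary if `Ext²` vanishes. -/
class IsHereditary : Prop where
  subsingleton_ext_two (X Y : H) : Subsingleton (Ext.{max u v} X Y 2)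

lemma IsFiniteHereditary.isHereditary {k : Type*} [Field k] [Linear k H]
    (h : IsFiniteHereditary k H) : IsHereditary H :=
  ⟨h.ext_two⟩

variable [IsHereditary H]

lemma singleFunctor_hom_shift_eq_zero_of_two_le {M N : H} {m : ℤ} (hm : 2 ≤ m)
    (f : (singleFunctor H 0).obj M ⟶ ((singleFunctor H 0).obj N)⟦m⟧) : f = 0 := by
  obtain ⟨n, rfl⟩ : ∃ n : ℕ, m = n := ⟨m.toNat, by lia⟩
  have := subsingleton_ext_of_le IsHereditary.subsingleton_ext_two M N (m := n) (by lia)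
  exact Ext.homEquiv.symm.injective (Subsingleton.elim _ _)

lemma hom_eq_zero_of_isGE_of_isLE {X Y : DerivedCategory H} (hX : t.bounded X) (hY : t.bounded Y)
    {a b : ℤ} (hab : b + 2 ≤ a) (ha : X.IsGE a) (hb : Y.IsLE b) (f : X ⟶ Y) : f = 0 := by
  obtain ⟨-, ⟨a', ha'⟩⟩ := hX
  obtain ⟨⟨b', hb'⟩, -⟩ := hY
  suffices (ObjectProperty.singleton Y).leftOrthogonal X from this f (by simp)
  refine prop_of_isGE_of_isLE (le_max_left a a') (fun n hn _ X _ _ => ?_) ha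
    (t.isLE_of_le X a' (max a a') (le_max_right a a'))
  rintro _ f ⟨_⟩
  suffices (ObjectProperty.singleton X).rightOrthogonal Y from this f (by simp)
  refine prop_of_isGE_of_isLE (min_le_right b' b) (fun m _ hm Y _ _ => ?_)
    (t.isGE_of_ge Y (min b' b) b' (min_le_left b' b)) hb
  rintro _ f ⟨_⟩
  obtain ⟨M, ⟨α⟩⟩ := exists_iso_singleFunctor_obj_shift X n
  obtain ⟨N, ⟨β⟩⟩ := exists_iso_singleFunctor_obj_shift Y m
  revert f
  rw [forall_hom_eq_zero_congr (α.homCongr β),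
    shift_hom_shift_eq_zero_iff (by lia : -n + (n - m) = -m)]
  exact singleFunctor_hom_shift_eq_zero_of_two_le (by lia)

variable (H) in
lemma isBoundedHereditary_tBounded : IsBoundedHereditary (tBounded H) where
  bounded X := by
    obtain ⟨⟨a, ha⟩, ⟨b, hb⟩⟩ := X.property
    exact ⟨⟨a, (ObjectProperty.tStructure_isGE_iff ..).2 ha⟩,
      ⟨b, (ObjectProperty.tStructure_isLE_iff ..).2 hb⟩⟩
  hom_eq_zero {X Y} a b hab hX hY f := by
    apply t.bounded.ι.map_injective
    rw [Functor.map_zero]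
    exact hom_eq_zero_of_isGE_of_isLE X.property Y.property hab
      ((ObjectProperty.tStructure_isGE_iff ..).1 hX)
      ((ObjectProperty.tStructure_isLE_iff ..).1 hY) _

instance : IsIdempotentComplete (Bounded H) :=
  (isBoundedHereditary_tBounded H).isIdempotentComplete fun n X hn hn' => by
    obtain ⟨M, ⟨e⟩⟩ := exists_iso_lift_singleFunctor_obj hn hn'
    exact idempotentsSplit.prop_of_iso e.symm (idempotentsSplit_obj _
      (IsIdempotentComplete.idempotents_split M))

end Hereditary

section Perpendicular

open DerivedCategory DerivedCategory.TStructure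

variable {H : Type u} [Category.{v} H] [Abelian H] (D : Bounded H)

lemma perpZ_eq_inverseImage : perpZ D = (shiftPerp D.obj).inverseImage (singleFunctor H 0) :=
  rfl

instance : (perpZ D).IsClosedUnderIsomorphisms := by
  rw [perpZ_eq_inverseImage]
  infer_instance

instance : (perpZ D).ContainsZero := by
  rw [perpZ_eq_inverseImage]
  infer_instance

instance : (perpZ D).IsClosedUnderExtensions where
  prop_X₂_of_shortExact hS h₁ h₃ := (shiftPerp D.obj).ext_of_isTriangulatedClosed₂ _
    hS.singleTriangle_distinguished h₁ h₃

instance : (perpZ D).IsClosedUnderFiniteProducts where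
  isClosedUnderLimitsOfShape _ _ := by
    rw [perpZ_eq_inverseImage]
    infer_instance

variable {D}

lemma perpZ_ext₁ {S : ShortComplex H} (hS : S.ShortExact) (h₂ : perpZ D S.X₂)
    (h₃ : perpZ D S.X₃) : perpZ D S.X₁ :=
  (shiftPerp D.obj).ext_of_isTriangulatedClosed₁ _ hS.singleTriangle_distinguished h₂ h₃

lemma perpZ_ext₃ {S : ShortComplex H} (hS : S.ShortExact) (h₁ : perpZ D S.X₁)
    (h₂ : perpZ D S.X₂) : perpZ D S.X₃ :=
  (shiftPerp D.obj).ext_of_isTriangulatedClosed₃ _ hS.singleTriangle_distinguished h₁ h₂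

variable [IsHereditary H]

/-- As `Ext² = 0`, the class of `0 ⟶ K ⟶ M ⟶ I ⟶ 0` is induced by a class on `N`. Hence it
vanishes on maps from shifts of `D` to `I`, so that these maps lift to `M`. -/
lemma perpZ_of_epi_of_mono {M I N : H} (p : M ⟶ I) [Epi p] (i : I ⟶ N) [Mono i]
    (hM : perpZ D M) (hN : perpZ D N) : perpZ D I := by
  have hS₁ : (ShortComplex.mk _ _ (kernel.condition p)).ShortExact :=
    { exact := ShortComplex.exact_kernel p }
  have hS₂ : (ShortComplex.mk _ _ (cokernel.condition i)).ShortExact :=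
    { exact := ShortComplex.exact_cokernel i }
  obtain ⟨ξ, hξ⟩ := Ext.contravariant_sequence_exact₁ hS₂ (kernel p) hS₁.extClass
    one_add_one_eq_two ((IsHereditary.subsingleton_ext_two _ _).elim _ _)
  replace hξ : (singleFunctor H 0).map i ≫ ξ.hom = hS₁.singleδ := by
    rw [← hS₁.extClass_hom, ← hξ, Ext.singleFunctor_map_comp_hom]
  refine shiftPerp_iff.2 fun s f => ?_
  obtain ⟨g, rfl⟩ : ∃ g : D.obj⟦s⟧ ⟶ (singleFunctor H 0).obj M,
      f = g ≫ (singleFunctor H 0).map p := by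
    refine Triangle.coyoneda_exact₃ _ hS₁.singleTriangle_distinguished f
      (?_ : f ≫ hS₁.singleδ = 0)
    rw [← hξ, reassoc_of% (shiftPerp_iff.1 hN s (f ≫ _)), zero_comp]
  rw [shiftPerp_iff.1 hM s g, zero_comp]

instance : (perpZ D).IsClosedUnderKernels where
  kernels_le := by
    rintro _ ⟨f, c, hc, hf⟩
    have hI := perpZ_of_epi_of_mono (factorThruImage f) (Limits.image.ι f) hf.1 hf.2
    have hS : (ShortComplex.mk _ _ (kernel.condition (factorThruImage f))).ShortExact :=
      { exact := ShortComplex.exact_kernel _ }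
    exact (perpZ D).prop_of_iso ((kernelCompMono _ _).symm ≪≫
      kernelIsoOfEq (Limits.image.fac f) ≪≫ (kernelIsKernel f).conePointUniqueUpToIso hc)
      (perpZ_ext₁ hS hf.1 hI)

instance : (perpZ D).IsClosedUnderCokernels where
  cokernels_le := by
    rintro _ ⟨f, c, hc, hf⟩
    have hI := perpZ_of_epi_of_mono (factorThruImage f) (Limits.image.ι f) hf.1 hf.2
    have hS : (ShortComplex.mk _ _ (cokernel.condition (Limits.image.ι f))).ShortExact :=
      { exact := ShortComplex.exact_cokernel _ }
    exact (perpZ D).prop_of_iso ((cokernelEpiComp _ _).symm ≪≫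
      cokernelIsoOfEq (Limits.image.fac f) ≪≫
      (cokernelIsCokernel f).coconePointUniqueUpToIso hc) (perpZ_ext₃ hS hI hf.2)

end Perpendicular

section ShiftedHomBijective

universe v' u'

variable {C : Type u} [Category.{v} C] {B : Type u'} [Category.{v'} B] {G : C ⥤ B}

lemma map_bijective_of_iso {X X' Y Y' : C} (α : X ≅ X') (β : Y ≅ Y')
    (h : Function.Bijective (G.map : (X ⟶ Y) → _)) :
    Function.Bijective (G.map : (X' ⟶ Y') → _) := by
  refine (Function.Bijective.of_comp_iff _ (α.homCongr β).bijective).1 ?_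
  convert ((G.mapIso α).homCongr (G.mapIso β)).bijective.comp h using 1
  ext f
  simp [Iso.homCongr]

variable [HasShift C ℤ]

lemma map_bijective_shift [HasShift B ℤ] [G.CommShift ℤ] {X Y : C} (n : ℤ)
    (h : Function.Bijective (G.map : (X ⟶ Y) → _)) :
    Function.Bijective (G.map : (X⟦n⟧ ⟶ Y⟦n⟧) → _) := by
  have hs : Function.Bijective ((shiftFunctor C n).map : (X ⟶ Y) → (X⟦n⟧ ⟶ Y⟦n⟧)) :=
    ⟨(shiftFunctor C n).map_injective, (shiftFunctor C n).map_surjective⟩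
  have hs' : Function.Bijective
      ((shiftFunctor B n).map : (G.obj X ⟶ G.obj Y) → ((G.obj X)⟦n⟧ ⟶ (G.obj Y)⟦n⟧)) :=
    ⟨(shiftFunctor B n).map_injective, (shiftFunctor B n).map_surjective⟩
  refine (Function.Bijective.of_comp_iff _ hs).1 ?_
  have hG : (G.map : (X⟦n⟧ ⟶ Y⟦n⟧) → _) ∘ (shiftFunctor C n).map =
      (((G.commShiftIso n).app X).homCongr ((G.commShiftIso n).app Y)).symm ∘
        (shiftFunctor B n).map ∘ G.map := by
    ext f
    simp [Iso.homCongr]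
  rw [hG]
  exact (Equiv.bijective _).comp (hs'.comp h)

variable (G) in
/-- The functor `G` induces bijections `Hom(X, Y[s]) → Hom(G(X), G(Y[s]))` for all `s`. -/
def IsShiftedHomBijective (X Y : C) : Prop :=
  ∀ s : ℤ, Function.Bijective (G.map : (X ⟶ Y⟦s⟧) → _)

namespace IsShiftedHomBijective

variable {X Y : C}

lemma of_iso {X' Y' : C} (h : IsShiftedHomBijective G X Y) (α : X ≅ X') (β : Y ≅ Y') :
    IsShiftedHomBijective G X' Y' := fun s =>
  map_bijective_of_iso α ((shiftFunctor C s).mapIso β) (h s)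

lemma map_bijective (h : IsShiftedHomBijective G X Y) :
    Function.Bijective (G.map : (X ⟶ Y) → _) :=
  map_bijective_of_iso (Iso.refl X) ((shiftFunctorZero C ℤ).app Y) (h 0)

lemma shift_right (h : IsShiftedHomBijective G X Y) (a : ℤ) :
    IsShiftedHomBijective G X (Y⟦a⟧) := fun s =>
  map_bijective_of_iso (Iso.refl X) ((shiftFunctorAdd C a s).app Y) (h (a + s))

lemma shift_left [HasShift B ℤ] [G.CommShift ℤ] (h : IsShiftedHomBijective G X Y) (a : ℤ) :
    IsShiftedHomBijective G (X⟦a⟧) Y := fun s =>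
  map_bijective_of_iso (Iso.refl _) ((shiftFunctorAdd' C (s - a) a s (by simp)).symm.app Y)
    (map_bijective_shift a (h (s - a)))

end IsShiftedHomBijective

instance (Y : C) : ObjectProperty.IsClosedUnderIsomorphisms (IsShiftedHomBijective G · Y) where
  of_iso e h := h.of_iso e (Iso.refl Y)

instance (X : C) : ObjectProperty.IsClosedUnderIsomorphisms (IsShiftedHomBijective G X) where
  of_iso e h := h.of_iso (Iso.refl X) e

variable [HasShift B ℤ] [HasZeroObject C] [Preadditive C]
  [∀ n : ℤ, (shiftFunctor C n).Additive] [Pretriangulated C] [HasZeroObject B] [Preadditive B]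
  [∀ n : ℤ, (shiftFunctor B n).Additive] [Pretriangulated B] [G.CommShift ℤ] [G.IsTriangulated]

lemma map_bijective_of_distTriang_right {T : Triangle C} (hT : T ∈ distTriang C) {X : C}
    (h₀ : Function.Surjective (G.map : (X ⟶ T.obj₃⟦(-1 : ℤ)⟧) → _))
    (h₁ : Function.Bijective (G.map : (X ⟶ T.obj₁) → _))
    (h₃ : Function.Bijective (G.map : (X ⟶ T.obj₃) → _))
    (h₄ : Function.Injective (G.map : (X ⟶ T.obj₁⟦(1 : ℤ)⟧) → _)) :
    Function.Bijective (G.map : (X ⟶ T.obj₂) → _) :=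
  have hT₀ := inv_rot_of_distTriang T hT
  have hT₁ := rot_of_distTriang T hT
  AddMonoidHom.bijective_of_surjective_of_bijective_of_bijective_of_injective
    (Preadditive.rightComp X T.invRotate.mor₁) (Preadditive.rightComp X T.mor₁)
    (Preadditive.rightComp X T.mor₂) (Preadditive.rightComp X T.mor₃)
    (Preadditive.rightComp (G.obj X) (G.map T.invRotate.mor₁))
    (Preadditive.rightComp (G.obj X) (G.map T.mor₁))
    (Preadditive.rightComp (G.obj X) (G.map T.mor₂))
    (Preadditive.rightComp (G.obj X) (G.map T.mor₃))
    G.mapAddHom G.mapAddHom G.mapAddHom G.mapAddHom G.mapAddHom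
    (AddMonoidHom.ext fun _ => (G.map_comp _ _).symm)
    (AddMonoidHom.ext fun _ => (G.map_comp _ _).symm)
    (AddMonoidHom.ext fun _ => (G.map_comp _ _).symm)
    (AddMonoidHom.ext fun _ => (G.map_comp _ _).symm)
    (rightComp_exact hT₀ X) (rightComp_exact hT X) (rightComp_exact hT₁ X)
    (rightComp_exact (G.map_distinguished _ hT₀) _) (rightComp_exact (G.map_distinguished _ hT) _)
    (rightComp_exact (G.map_distinguished _ hT₁) _) h₀ h₁ h₃ h₄

lemma map_bijective_of_distTriang_left {T : Triangle C} (hT : T ∈ distTriang C) {Y : C}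
    (h₀ : Function.Injective (G.map : (T.obj₃⟦(-1 : ℤ)⟧ ⟶ Y) → _))
    (h₁ : Function.Bijective (G.map : (T.obj₁ ⟶ Y) → _))
    (h₃ : Function.Bijective (G.map : (T.obj₃ ⟶ Y) → _))
    (h₄ : Function.Surjective (G.map : (T.obj₁⟦(1 : ℤ)⟧ ⟶ Y) → _)) :
    Function.Bijective (G.map : (T.obj₂ ⟶ Y) → _) :=
  have hT₀ := inv_rot_of_distTriang T hT
  have hT₁ := rot_of_distTriang T hT
  AddMonoidHom.bijective_of_surjective_of_bijective_of_bijective_of_injective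
    (Preadditive.leftComp Y T.mor₃) (Preadditive.leftComp Y T.mor₂)
    (Preadditive.leftComp Y T.mor₁) (Preadditive.leftComp Y T.invRotate.mor₁)
    (Preadditive.leftComp (G.obj Y) (G.map T.mor₃))
    (Preadditive.leftComp (G.obj Y) (G.map T.mor₂))
    (Preadditive.leftComp (G.obj Y) (G.map T.mor₁))
    (Preadditive.leftComp (G.obj Y) (G.map T.invRotate.mor₁))
    G.mapAddHom G.mapAddHom G.mapAddHom G.mapAddHom G.mapAddHom
    (AddMonoidHom.ext fun _ => (G.map_comp _ _).symm)
    (AddMonoidHom.ext fun _ => (G.map_comp _ _).symm)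
    (AddMonoidHom.ext fun _ => (G.map_comp _ _).symm)
    (AddMonoidHom.ext fun _ => (G.map_comp _ _).symm)
    (leftComp_exact hT₁ Y) (leftComp_exact hT Y) (leftComp_exact hT₀ Y)
    (leftComp_exact (G.map_distinguished _ hT₁) _) (leftComp_exact (G.map_distinguished _ hT) _)
    (leftComp_exact (G.map_distinguished _ hT₀) _) h₄ h₃ h₁ h₀

instance (X : C) : ObjectProperty.IsTriangulatedClosed₂ (IsShiftedHomBijective G X) :=
  .mk' fun T hT h₁ h₃ s =>
    map_bijective_of_distTriang_right (Triangle.shift_distinguished T hT s)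
      ((h₃.shift_right s).shift_right (-1)).map_bijective.2 (h₁ s) (h₃ s)
      ((h₁.shift_right s).shift_right 1).map_bijective.1

instance (Y : C) : ObjectProperty.IsTriangulatedClosed₂ (IsShiftedHomBijective G · Y) :=
  .mk' fun _ hT h₁ h₃ s =>
    map_bijective_of_distTriang_left hT (h₃.shift_left (-1) s).1 (h₁ s) (h₃ s)
      (h₁.shift_left 1 s).2

end ShiftedHomBijective

section FullyFaithful

variable {C C' : Type*} [Category* C] [Category* C'] [Preadditive C] [Preadditive C']
  [HasShift C ℤ] [HasShift C' ℤ] (G : C ⥤ C') [G.CommShift ℤ] [G.Full] [G.Faithful]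

lemma map_hom_shift_eq_zero_iff (X Y : C) (n : ℤ) :
    (∀ f : G.obj X ⟶ (G.obj Y)⟦n⟧, f = 0) ↔ ∀ f : X ⟶ Y⟦n⟧, f = 0 :=
  (forall_hom_eq_zero_congr ((Functor.FullyFaithful.ofFullyFaithful G).homEquiv.trans
    ((Iso.refl _).homCongr ((G.commShiftIso n).app Y)))).symm

lemma shiftPerp_map_iff (D Y : C) : shiftPerp (G.obj D) (G.obj Y) ↔ shiftPerp D Y :=
  forall_congr' fun n => map_hom_shift_eq_zero_iff G D Y n

end FullyFaithful

section DerivedFunctor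

open DerivedCategory DerivedCategory.TStructure

variable {H : Type u} [Category.{v} H] [Abelian H] {W : Type u} [Category.{v} W] [Abelian W]
  (F : W ⥤ H) [F.Additive] [PreservesFiniteLimits F] [PreservesFiniteColimits F]

/-- The derived functor of the exact functor `F` sends `M[n]` to `F(M)[n]`. -/
noncomputable def mapDerivedCategorySingleShiftIso (M : W) (n : ℤ) :
    F.mapDerivedCategory.obj (((singleFunctor W 0).obj M)⟦n⟧) ≅
      ((singleFunctor H 0).obj (F.obj M))⟦n⟧ :=
  (F.mapDerivedCategory.commShiftIso n).app _ ≪≫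
    (shiftFunctor _ n).mapIso ((F.mapDerivedCategorySingleFunctor 0).app M)

lemma prop_mapDerivedCategory_obj (P : ObjectProperty (DerivedCategory H)) [P.IsTriangulated]
    [P.IsClosedUnderIsomorphisms] (hP : ∀ M : W, P ((singleFunctor H 0).obj (F.obj M)))
    (X : Bounded W) : P (F.mapDerivedCategory.obj X.obj) :=
  bounded_le (P := P.inverseImage F.mapDerivedCategory)
    (fun M n => P.prop_of_iso (mapDerivedCategorySingleShiftIso F M n).symm
      (P.le_shift n _ (hP M))) _ X.property

/-- The functor between bounded derived categories induced by an exact functor. -/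
noncomputable abbrev mapBounded : Bounded W ⥤ Bounded H :=
  t.bounded.lift (Bounded.ι ⋙ F.mapDerivedCategory)
    (prop_mapDerivedCategory_obj F t.bounded fun M => bounded_singleFunctor_obj (F.obj M) 0)

instance (k : Type*) [Field k] [Linear k H] [Linear k W] [F.Linear k] :
    (mapBounded F).Linear k where
  map_smul f r := by
    apply Bounded.ι.map_injective
    exact Functor.Linear.map_smul (F := F.mapDerivedCategory) (Bounded.ι.map f) r

variable {F} in
lemma map_singleFunctor_hom_bijective {M N : W} {n : ℕ}
    (h : Function.Bijective (F.mapExtAddHom M N n)) :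
    Function.Bijective (F.mapDerivedCategory.map :
      ((singleFunctor W 0).obj M ⟶ ((singleFunctor W 0).obj N)⟦(n : ℤ)⟧) → _) := by
  let e := ((F.mapDerivedCategorySingleFunctor 0).app M).homCongr
    (mapDerivedCategorySingleShiftIso F N n)
  have he : (e ∘ F.mapDerivedCategory.map) ∘ Ext.homEquiv =
      Ext.homEquiv ∘ F.mapExtAddHom M N n := by
    ext ξ
    refine Eq.trans ?_ (Ext.mapExactFunctor_hom F ξ).symm
    simp [e, Iso.homCongr, mapDerivedCategorySingleShiftIso, ShiftedHom.map]
  refine (Function.Bijective.of_comp_iff' e.bijective _).1 ?_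
  refine (Function.Bijective.of_comp_iff _ Ext.homEquiv.bijective).1 ?_
  rw [he]
  exact Ext.homEquiv.bijective.comp h

variable {F} in
lemma mem_essImage_mapBounded_of_isGE_of_isLE {D : Bounded H}
    (hF : F.essImage = perpZ D) {n : ℤ} {X : Bounded H} (hn : (tBounded H).IsGE X n)
    (hn' : (tBounded H).IsLE X n) (hX : shiftPerp D X) :
    (mapBounded F).essImage X := by
  have := (ObjectProperty.tStructure_isGE_iff ..).1 hn
  have := (ObjectProperty.tStructure_isLE_iff ..).1 hn'
  obtain ⟨M, ⟨α⟩⟩ := exists_iso_singleFunctor_obj_shift X.obj n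
  have hM : perpZ D M := by
    refine ((shiftPerp D.obj).prop_shift_iff_of_isStableUnderShift _ (-n)).1 ?_
    exact (shiftPerp D.obj).prop_of_iso α ((shiftPerp_map_iff Bounded.ι D X).2 hX)
  obtain ⟨N, ⟨β⟩⟩ := hF.ge _ hM
  exact ⟨⟨_, t.bounded.le_shift (-n) _ (bounded_singleFunctor_obj N 0)⟩,
    ⟨t.bounded.fullyFaithfulι.preimageIso (mapDerivedCategorySingleShiftIso F N (-n) ≪≫
      (shiftFunctor _ (-n)).mapIso ((singleFunctor H 0).mapIso β) ≪≫ α.symm)⟩⟩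

variable [F.Full] [F.Faithful] [F.essImage.IsClosedUnderExtensions] [IsHereditary H]

include F in
lemma IsHereditary.of_fullyFaithful : IsHereditary W where
  subsingleton_ext_two M N :=
    have h₁ (M N : W) : Function.Bijective (F.mapExtAddHom M N 1) :=
      ⟨mapExtAddHom_succ_injective F (mapExtAddHom_zero_bijective F) M N,
        mapExtAddHom_one_surjective F M N⟩
    have := IsHereditary.subsingleton_ext_two (F.obj M) (F.obj N)
    (mapExtAddHom_succ_injective F h₁ M N).subsingleton

lemma mapExtAddHom_bijective (M N : W) : ∀ n : ℕ, Function.Bijective (F.mapExtAddHom M N n)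
  | 0 => mapExtAddHom_zero_bijective F M N
  | 1 => ⟨mapExtAddHom_succ_injective F (mapExtAddHom_zero_bijective F) M N,
      mapExtAddHom_one_surjective F M N⟩
  | n + 2 => by
    have := IsHereditary.of_fullyFaithful F
    have := subsingleton_ext_of_le IsHereditary.subsingleton_ext_two M N (m := n + 2) (by lia)
    have := subsingleton_ext_of_le IsHereditary.subsingleton_ext_two (F.obj M) (F.obj N)
      (m := n + 2) (by lia)
    exact ⟨Function.injective_of_subsingleton _, Function.surjective_to_subsingleton _⟩

lemma IsFiniteHereditary.of_fullyFaithful {k : Type*} [Field k] [Linear k H] [Linear k W]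
    [F.Linear k] (hH : IsFiniteHereditary k H) : IsFiniteHereditary k W where
  hom_finite X Y :=
    have := hH.hom_finite (F.obj X) (F.obj Y)
    Module.Finite.of_injective (F.mapLinearMap k (X := X) (Y := Y)) F.map_injective
  ext_finite X Y n :=
    have := hH.ext_finite (F.obj X) (F.obj Y) n
    Module.Finite.of_injective (F.mapExtLinearMap k X Y n) (mapExtAddHom_bijective F X Y n).1
  ext_two := (IsHereditary.of_fullyFaithful F).subsingleton_ext_two

lemma isShiftedHomBijective_singleFunctor (M N : W) : IsShiftedHomBijective F.mapDerivedCategory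
    ((singleFunctor W 0).obj M) ((singleFunctor W 0).obj N) := by
  intro m
  obtain hm | hm := lt_or_ge m 0
  · have h₁ := singleFunctor_hom_shift_eq_zero_of_neg (M := M) (N := N) hm
    have h₂ := (forall_hom_eq_zero_congr (((F.mapDerivedCategorySingleFunctor 0).app M).homCongr
      (mapDerivedCategorySingleShiftIso F N m))).2 (singleFunctor_hom_shift_eq_zero_of_neg hm)
    exact ⟨fun f g _ => (h₁ f).trans (h₁ g).symm, fun f => ⟨0, (h₂ _).trans (h₂ f).symm⟩⟩
  · lift m to ℕ using hm
    exact map_singleFunctor_hom_bijective (mapExtAddHom_bijective F M N m)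

lemma isShiftedHomBijective_of_bounded {X Y : DerivedCategory W} (hX : t.bounded X)
    (hY : t.bounded Y) : IsShiftedHomBijective F.mapDerivedCategory X Y := by
  refine bounded_le (P := (IsShiftedHomBijective F.mapDerivedCategory · Y)) (fun M m => ?_) X hX
  refine bounded_le (P := IsShiftedHomBijective F.mapDerivedCategory _) (fun N n => ?_) Y hY
  exact ((isShiftedHomBijective_singleFunctor F M N).shift_left m).shift_right n

instance : (mapBounded F).Faithful where
  map_injective {X Y} _ _ hfg := Bounded.ι.map_injective
    ((isShiftedHomBijective_of_bounded F X.property Y.property).map_bijective.1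
      (Bounded.ι.congr_map hfg))

instance : (mapBounded F).Full where
  map_surjective {X Y} f := by
    obtain ⟨g, hg⟩ := (isShiftedHomBijective_of_bounded F X.property Y.property).map_bijective.2
      (Bounded.ι.map f)
    obtain ⟨g, rfl⟩ := Bounded.ι.map_surjective (X := X) (Y := Y) g
    exact ⟨g, Bounded.ι.map_injective hg⟩

variable {F} in
lemma essImage_mapBounded {D : Bounded H} (hF : F.essImage = perpZ D) :
    (mapBounded F).essImage = shiftPerp D := by
  refine le_antisymm ?_ fun X => ?_
  · rintro X ⟨Y, ⟨α⟩⟩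
    refine (shiftPerp D).prop_of_iso α ((shiftPerp_map_iff Bounded.ι D _).1 ?_)
    exact prop_mapDerivedCategory_obj F (shiftPerp D.obj)
      (fun M => (hF.le _ (F.obj_mem_essImage M) : perpZ D (F.obj M))) Y
  · let P : ObjectProperty (Bounded H) := fun X => shiftPerp D X → (mapBounded F).essImage X
    have : P.IsClosedUnderIsomorphisms := ⟨fun e h hX =>
      (mapBounded F).essImage.prop_of_iso e (h ((shiftPerp D).prop_of_iso e.symm hX))⟩
    refine (isBoundedHereditary_tBounded H).prop_of_biprod (P := P)
      (fun _ _ => mem_essImage_mapBounded_of_isGE_of_isLE hF) (fun _ X Y _ _ hX hY hXY => ?_) X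
    exact (mapBounded F).essImage.ext_of_isTriangulatedClosed₂ _
      (binaryBiproductTriangle_distinguished X Y)
      (hX ((shiftPerp D).prop_of_retract ⟨biprod.inl, biprod.fst, biprod.inl_fst⟩ hXY))
      (hY ((shiftPerp D).prop_of_retract ⟨biprod.inr, biprod.snd, biprod.inr_snd⟩ hXY))

end DerivedFunctor

section SiltingReduction

open DerivedCategory DerivedCategory.TStructure

variable {H : Type u} [Category.{v} H] [Abelian H]

lemma essImage_perpZ_ι (D : Bounded H) : (perpZ D).ι.essImage = perpZ D := by
  ext M
  exact ⟨fun ⟨N, ⟨α⟩⟩ => (perpZ D).prop_of_iso α N.property, fun h => ⟨⟨M, h⟩, ⟨Iso.refl _⟩⟩⟩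

instance (D : Bounded H) : (perpZ D).ι.essImage.IsClosedUnderExtensions := by
  rw [essImage_perpZ_ι]
  infer_instance

variable [IsHereditary H]

instance (D : Bounded H) : PreservesFiniteLimits (perpZ D).ι :=
  have := (perpZ D).preservesKernels_ι
  Functor.preservesFiniteLimits_of_preservesKernels _

instance (D : Bounded H) : PreservesFiniteColimits (perpZ D).ι :=
  have := (perpZ D).preservesCokernels_ι
  Functor.preservesFiniteColimits_of_preservesCokernels _

variable {k : Type*} [Field k] [Linear k H]
  (h : ∀ (M N : H) (n : ℕ), Module.Finite k (Ext.{max u v} M N n))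
include h

lemma exists_silting_perpZ {T D : Bounded H} (hT : IsSilting T) (r : Retract D T) :
    ∃ T' : Bounded (perpZ D).FullSubcategory,
      IsSilting T' ∧ (IsBasic T → IsBasic T') ∧ (IsTwoTerm T → IsTwoTerm T') ∧
      Nonempty (IdemQuotient (retractIdempotent r) ≃ₐ[k] End T') := by
  have := finite_bounded_hom k h
  obtain ⟨T', hT', hbasic, hhom, hquot⟩ := exists_silting_reduction
    (F := mapBounded (perpZ D).ι) (isBoundedHereditary_tBounded H) k hT r
    (essImage_mapBounded (essImage_perpZ_ι D))
  refine ⟨T', hT', hbasic, fun hTwo M n h₀ h₁ => ?_, hquot⟩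
  let Y : Bounded (perpZ D).FullSubcategory :=
    ⟨(singleFunctor _ 0).obj M, bounded_singleFunctor_obj M 0⟩
  let α := ((perpZ D).ι.mapDerivedCategorySingleFunctor 0).app M
  refine (map_hom_shift_eq_zero_iff Bounded.ι T' Y n).2 (hhom Y n ?_)
  refine (map_hom_shift_eq_zero_iff Bounded.ι T _ n).1 ?_
  exact (forall_hom_eq_zero_congr
    ((Iso.refl _).homCongr ((shiftFunctor _ n).mapIso α))).2 (hTwo M.obj n h₀ h₁)

lemma exists_silting_perpZ_of_isIdempotentElem {A : Type*} [Ring A] [Algebra k A] {e : A}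
    (he : IsIdempotentElem e) {T : Bounded H} (hT : IsSilting T) (φ : A ≃ₐ[k] End T) :
    ∃ (D : Bounded H) (i : D ⟶ T) (r : T ⟶ D), i ≫ r = 𝟙 D ∧ r ≫ i = φ e ∧
      ∃ T' : Bounded (perpZ D).FullSubcategory,
        IsSilting T' ∧ (IsBasic T → IsBasic T') ∧ (IsTwoTerm T → IsTwoTerm T') ∧
        Nonempty (IdemQuotient e ≃ₐ[k] End T') := by
  obtain ⟨D, i, r, hir, hri⟩ := IsIdempotentComplete.idempotents_split T (φ e) (he.map φ)
  obtain ⟨T', hT', hbasic, htwo, ⟨ψ⟩⟩ := exists_silting_perpZ h hT ⟨i, r, hir⟩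
  obtain ⟨χ⟩ := nonempty_idemQuotient_congr φ e
  rw [← hri] at χ
  exact ⟨D, i, r, hir, hri, T', hT', hbasic, htwo, ⟨χ.trans ψ⟩⟩

end SiltingReduction

end SiltingQuotient

open SiltingQuotient in
theorem theorem3p3 (k : Type*) [Field k] (A : Type*) [Ring A] [Algebra k A]
    (e : A) (he : IsIdempotentElem e) :
    (IsSiltingEndAlgebra.{v, u} k A → IsSiltingEndAlgebra.{v, u} k (IdemQuotient e)) ∧
    (IsQuasiSilted.{v, u} k A → IsQuasiSilted.{v, u} k (IdemQuotient e)) ∧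
    ∀ (H : Type u) [Category.{v} H] [Abelian H] [Linear k H], IsFiniteHereditary k H →
      ∀ T : DerivedCategory.Bounded H, IsSilting T → ∀ φ : A ≃ₐ[k] End T,
        ∃ (D : DerivedCategory.Bounded H) (i : D ⟶ T) (r : T ⟶ D),
          i ≫ r = 𝟙 D ∧ r ≫ i = φ e ∧
          ∃ (_ : (perpZ D).ContainsZero) (_ : (perpZ D).IsClosedUnderKernels)
            (_ : (perpZ D).IsClosedUnderCokernels) (_ : (perpZ D).IsClosedUnderFiniteProducts),
            IsFiniteHereditary k (perpZ D).FullSubcategory ∧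
            ∃ T' : DerivedCategory.Bounded (perpZ D).FullSubcategory,
              IsSilting T' ∧ (IsBasic T → IsBasic T') ∧ (IsTwoTerm T → IsTwoTerm T') ∧
              Nonempty (IdemQuotient e ≃ₐ[k] End T') := by
  refine ⟨?_, ?_, fun H _ _ _ hH T hT φ => ?_⟩
  · rintro ⟨H, _, _, _, T, hH, hT, hbasic, ⟨φ⟩⟩
    have := hH.isHereditary
    obtain ⟨D, _, _, -, -, T', hT', hbasic', -, hφ'⟩ :=
      exists_silting_perpZ_of_isIdempotentElem hH.ext_finite he hT φ
    exact ⟨(perpZ D).FullSubcategory, inferInstance, inferInstance, inferInstance, T',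
      hH.of_fullyFaithful (perpZ D).ι, hT', hbasic' hbasic, hφ'⟩
  · rintro ⟨H, _, _, _, T, hH, hT, htwo, hbasic, ⟨φ⟩⟩
    have := hH.isHereditary
    obtain ⟨D, _, _, -, -, T', hT', hbasic', htwo', hφ'⟩ :=
      exists_silting_perpZ_of_isIdempotentElem hH.ext_finite he hT φ
    exact ⟨(perpZ D).FullSubcategory, inferInstance, inferInstance, inferInstance, T',
      hH.of_fullyFaithful (perpZ D).ι, hT', htwo' htwo, hbasic' hbasic, hφ'⟩
  · have := hH.isHereditary
    obtain ⟨D, i, r, hir, hri, hT'⟩ :=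
      exists_silting_perpZ_of_isIdempotentElem hH.ext_finite he hT φ
    exact ⟨D, i, r, hir, hri, inferInstance, inferInstance, inferInstance, inferInstance,
      hH.of_fullyFaithful (perpZ D).ι, hT'⟩
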